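/- Let $\mathcal C$ be a category with finite products and a subcategory of \emph{covers} such that: every object having a global point covers the terminal object $*$; pullbacks of covers along arbitrary maps exist and are covers; if $g$ and $fg$ are covers, then so is $f$; every cover is the coequalizer of its kernel pair. (For example: smooth manifolds with surjective submersions as covers.) For a map $f\colon X_\bullet\to Y_\bullet$ of simplicial objects in $\mathcal C$, let $M_k(f)=\hom(\partial\Delta^k,X)\times_{\hom(\partial\Delta^k,Y)}Y_k$ and $\Lambda^k_i(f)=\hom(\Lambda^k_i,X)\times_{\hom(\Lambda^k_i,Y)}Y_k$ (limits in $\mathcal C$, when they exist), with the canonical maps $\mu_k(f)\colon X_k\to M_k(f)$ and $\lambda^k_i(f)\colon X_k\to\Lambda^k_i(f)$. A \emph{Lie $\infty$-groupoid} is a simplicial object $X_\bullet$ such that, for all $k>0$ and $0\le i\le k$, $\Lambda^k_i(X)=\Lambda^k_i(X\to *)$ exists and $\lambda^k_i(X)$ is a cover. A \emph{hypercover} is a map $f$ of Lie $\infty$-groupoids such that, for all $k\ge 0$, $M_k(f)$ exists and $\mu_k(f)$ is a cover. For $n\ge 0$, let $P^{\ge n}(f)_\bullet$ be the pullback of $X^{\Delta^{n-1}\star}_\bullet\to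 X^{\partial\Delta^{n-1}\star}_\bullet\times_{Y^{\partial\Delta^{n-1}\star}_\bullet}Y^{\Delta^{n-1}\star}_\bullet$ along the map from the constant simplicial object $\Lambda^n_n(f)$, where $X^{S\star}_l=\hom(S\star\Delta^l,X)$; its vertices are $P^{\ge n}(f)_0=X_n$ (for $n=0$ this means $P^{\ge 0}(f)_l=X_l\times_{Y_l}Y_0$). An \emph{orbit space} $\pi_0(P)$ of a simplicial object $P$ is a cover $P_0\to\pi_0(P)$ which is a coequalizer of the two face maps $P_1\rightrightarrows P_0$. An \emph{$n$-strictification} of $f$ consists of maps $X_\bullet\xrightarrow{q}\tau_n(X,f)_\bullet\xrightarrow{\tau_n(f)}Y_\bullet$ with composite $f$ such that $q_k$ is an isomorphism for $k<n$; $q_n\colon X_n\to\tau_n(X,f)_n$ is an orbit space of $P^{\ge n}(f)$; $\tau_n(X,f)_{n+1}\cong\Lambda^{n+1}_1(\tau_n(f))$ via $\lambda^{n+1}_1(\tau_n(f))$; and $\tau_n(X,f)_\bullet\cong\mathrm{Csk}_{n+1}\tau_n(X,f)_\bullet\times_{\mathrm{Csk}_{n+1}Y_\bullet}Y_\bullet$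 canonically. Let $G$ be a Lie group and $A$ an abelian Lie group in $\mathcal C$ (group objects), and $n\ge 0$. Let $\overline W_\bullet G$ be the nerve of $G$, and $K(A,n)_\bullet$ the Eilenberg--MacLane simplicial object, given by the Dold--Kan construction: $K(A,n)_k$ is the product of copies of $A$ indexed by the monotone surjections $[k]\to[n]$. An \emph{$A$-valued $n$-cocycle} on $\overline W_\bullet G$ is a span $\overline W_\bullet G\xleftarrow{f}U_\bullet\xrightarrow{\varphi}K(A,n)_\bullet$ with $f$ a hypercover. An \emph{equivalence} between the cocycles $U^0$ and $U^1$ consists of a cocycle $V$ and hypercovers $V_\bullet\to U^0_\bullet$, $V_\bullet\to U^1_\bullet$ commuting with the maps to $\overline W_\bullet G$ and $K(A,n)_\bullet$. \textbf{Proposition.} Let $\overline W_\bullet G\xleftarrow{f}U_\bullet\xrightarrow{\varphi}K(A,n)_\bullet$ be an $A$-valued $n$-cocycle. Then an $n$-strictification $U_\bullet\xrightarrow{q}\tau_n(U,f)_\bullet\xrightarrow{\tau_n(f)}\overline W_\bullet G$ of $f$ exists, and for any such strictification there is a unique map $\psi\colon\tau_n(U,f)_\bullet\to K(A,n)_\bullet$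 with $\psi q=\varphi$. Moreover $\overline W_\bullet G\xleftarrow{\tau_n(f)}\tau_n(U,f)_\bullet\xrightarrow{\psi}K(A,n)_\bullet$ is again an $A$-valued $n$-cocycle (that is, $\tau_n(f)$ is a hypercover), and $U_\bullet\xleftarrow{\mathrm{id}}U_\bullet\xrightarrow{q}\tau_n(U,f)_\bullet$ is an equivalence of cocycles from $(U_\bullet,f,\varphi)$ to $(\tau_n(U,f)_\bullet,\tau_n(f),\psi)$; in particular $q$ is a hypercover. -/

import Mathlib

open CategoryTheory Limits Opposite Simplicial MonoidalCategory CartesianMonoidalCategory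
open scoped MonObj

universe v u

namespace LieStack

section Covers

variable {C : Type u} [Category.{v} C] [CartesianMonoidalCategory C]

/-- The axioms on the class `W` of covers of a category `C` with finite products (the terminal
object is `𝟙_ C`).

Every object `X` with a global point covers the terminal object. (Restricting to objects with a
global point weakens the requirement that all objects cover the terminal object; the unrestricted
form would forbid the empty set among sets, or the empty manifold among manifolds.) -/
structure IsCoverClass (W : MorphismProperty C) : Prop where
  /-- Covers form a subcategory. -/
  isMultiplicative : W.IsMultiplicative
  /-- The map to the terminal object is a cover. -/
  toUnit : ∀ X : C, Nonempty (𝟙_ C ⟶ X) → W (CartesianMonoidalCategory.toUnit X)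
  /-- Pullbacks of covers along arbitrary maps exist ... -/
  hasPullback : ∀ {X Y Z : C} (f : X ⟶ Y) (g : Z ⟶ Y), W f → HasPullback f g
  /-- ... and are covers. -/
  isStableUnderBaseChange : W.IsStableUnderBaseChange
  /-- Right cancellation: if `g ≫ f` and `g` are covers, then so is `f`. -/
  cancel : ∀ {X Y Z : C} (g : X ⟶ Y) (f : Y ⟶ Z), W g → W (g ≫ f) → W f
  /-- Covers are effective epimorphisms: a cover is the coequalizer of its kernel pair. -/
  effectiveEpi : ∀ {R X Y : C} (f : X ⟶ Y) (a b : R ⟶ X) (h : IsKernelPair f a b),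
    W f → Nonempty (IsColimit (Cofork.ofπ f h.w))

end Covers

section Simplicial

variable {C : Type u} [Category.{v} C]

/-- For a map `f : X ⟶ Y` of simplicial objects and a subcomplex `S` of `Δ[k]`, a `T`-valued
section of the limit `hom(S, X) ×_{hom(S, Y)} Y_k`: a compatible family of maps `T ⟶ X_m`, indexed
by the simplices `Δ[m] ⟶ S` (that is, a cone over the diagram of which `hom(S, X)` is the limit),
together with a map `T ⟶ Y_k` which restricts on `S` to the image of the family. -/
@[ext]
structure RelFamily {X Y : SimplicialObject C} (f : X ⟶ Y) {k : SimplexCategory}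
    (S : (SSet.stdSimplex.{0}.obj k).Subcomplex) (T : C) where
  /-- The value on the simplex `α : Δ[m] ⟶ Δ[k]` of `S`. -/
  app : ∀ (m : SimplexCategory) (α : m ⟶ k),
    SSet.stdSimplex.objEquiv.symm α ∈ S.obj (op m) → (T ⟶ X.obj (op m))
  /-- The `k`-simplex of `Y`. -/
  base : T ⟶ Y.obj (op k)
  app_map : ∀ (m m' : SimplexCategory) (θ : m' ⟶ m) (α : m ⟶ k)
    (hα : SSet.stdSimplex.objEquiv.symm α ∈ S.obj (op m))
    (hα' : SSet.stdSimplex.objEquiv.symm (θ ≫ α) ∈ S.obj (op m')),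
    app m α hα ≫ X.map θ.op = app m' (θ ≫ α) hα'
  app_comp : ∀ (m : SimplexCategory) (α : m ⟶ k)
    (hα : SSet.stdSimplex.objEquiv.symm α ∈ S.obj (op m)),
    app m α hα ≫ f.app (op m) = base ≫ Y.map α.op

namespace RelFamily

variable {X Y : SimplicialObject C} {f : X ⟶ Y} {k : SimplexCategory}
  {S : (SSet.stdSimplex.{0}.obj k).Subcomplex}

/-- Restriction of sections along `g : T' ⟶ T`. -/
def precomp {T T' : C} (d : RelFamily f S T) (g : T' ⟶ T) : RelFamily f S T' where
  app m α hα := g ≫ d.app m α hα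
  base := g ≫ d.base
  app_map m m' θ α hα hα' := by rw [Category.assoc, d.app_map m m' θ α hα hα']
  app_comp m α hα := by rw [Category.assoc, d.app_comp m α hα, Category.assoc]

variable (f S) in
/-- The section given by a `k`-simplex of `X`: its restriction to `S` and its image in `Y`. -/
def ofSimplex {T : C} (x : T ⟶ X.obj (op k)) : RelFamily f S T where
  app m α _ := x ≫ X.map α.op
  base := x ≫ f.app (op k)
  app_map m m' θ α _ _ := by simp
  app_comp m α _ := by simp

end RelFamily

/-- The limit `hom(S, X) ×_{hom(S, Y)} Y_k` in `C`; it need not exist in general. -/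
structure RelLimit {X Y : SimplicialObject C} (f : X ⟶ Y) {k : SimplexCategory}
    (S : (SSet.stdSimplex.{0}.obj k).Subcomplex) where
  obj : C
  family : RelFamily f S obj
  existsUnique : ∀ (T : C) (d : RelFamily f S T), ∃! g : T ⟶ obj, family.precomp g = d

/-- The canonical map `X_k ⟶ hom(S, X) ×_{hom(S, Y)} Y_k`. For `S = ∂Δ[k]` it is `μ_k(f)`, the map
to the matching object `M_k(f)`; for `S = Λ[k, i]` it is `λ^k_i(f)`, the map to the object
`Λ^k_i(f)` of relative horns. -/
noncomputable def RelLimit.comparison {X Y : SimplicialObject C} {f : X ⟶ Y} {k : SimplexCategory}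
    {S : (SSet.stdSimplex.{0}.obj k).Subcomplex} (L : RelLimit f S) : X.obj (op k) ⟶ L.obj :=
  (L.existsUnique _ (RelFamily.ofSimplex f S (𝟙 (X.obj (op k))))).choose

/-- A coequalizer `p : X_0 ⟶ Q` of the two face maps `X_1 ⟶ X_0` which is a cover: the orbit
space of `X`. -/
def IsOrbitSpace (W : MorphismProperty C) (X : SimplicialObject C) {Q : C} (p : X _⦋0⦌ ⟶ Q) :
    Prop :=
  W p ∧ ∃ w : X.δ (0 : Fin 2) ≫ p = X.δ (1 : Fin 2) ≫ p, Nonempty (IsColimit (Cofork.ofπ p w))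

end Simplicial

section Join

/-- The monotone map `[k - 1] + [a] = [k + a] ⟶ [k - 1] + [b] = [k + b]` which is the identity on the
first `k` elements and `θ` on the remaining ones. -/
def shiftHom (k : ℕ) {a b : ℕ} (θ : Fin (a + 1) →o Fin (b + 1)) :
    Fin (k + a + 1) →o Fin (k + b + 1) where
  toFun j := if h : j.val < k then ⟨j.val, by omega⟩ else
    ⟨k + (θ ⟨j.val - k, by omega⟩).val, by omega⟩
  monotone' := by
    intro i j hij
    have hij' : i.val ≤ j.val := hij
    dsimp only
    split_ifs with h1 h2 h2
    · exact hij
    · exact Fin.mk_le_mk.2 (by omega)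
    · omega
    · refine Fin.mk_le_mk.2 (Nat.add_le_add_left ?_ k)
      exact θ.monotone (Fin.mk_le_mk.2 (by omega))

lemma shiftHom_apply (k : ℕ) {a b : ℕ} (θ : Fin (a + 1) →o Fin (b + 1)) (j : Fin (k + a + 1)) :
    shiftHom k θ j = if h : j.val < k then ⟨j.val, by omega⟩ else
      ⟨k + (θ ⟨j.val - k, by omega⟩).val, by omega⟩ := rfl

lemma shiftHom_id (k a : ℕ) :
    shiftHom k (OrderHom.id : Fin (a + 1) →o Fin (a + 1)) = OrderHom.id := by
  refine OrderHom.ext _ _ (funext fun j => ?_)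
  by_cases h : j.val < k
  · simp [shiftHom, h]
  · ext
    simp [shiftHom, h]
    omega

lemma shiftHom_comp (k : ℕ) {a b c : ℕ} (θ : Fin (a + 1) →o Fin (b + 1))
    (ξ : Fin (b + 1) →o Fin (c + 1)) :
    shiftHom k (ξ.comp θ) = (shiftHom k ξ).comp (shiftHom k θ) := by
  refine OrderHom.ext _ _ (funext fun j => ?_)
  change shiftHom k (ξ.comp θ) j = shiftHom k ξ (shiftHom k θ j)
  by_cases h : j.val < k <;> simp [shiftHom_apply, h]

/-- The functor `Δ[k - 1] ⋆ (-)` on simplices, `[l] ↦ [k - 1] + [l] = [k + l]` (for `k = 0` it is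
the identity). -/
def shift (k : ℕ) : SimplexCategory ⥤ SimplexCategory where
  obj l := ⦋k + l.len⦌
  map θ := SimplexCategory.mkHom (shiftHom k θ.toOrderHom)
  map_id l := SimplexCategory.Hom.ext _ _ (shiftHom_id k l.len)
  map_comp θ ξ := SimplexCategory.Hom.ext _ _ (shiftHom_comp k θ.toOrderHom ξ.toOrderHom)

/-- The map `Δ[k - 1] ⋆ Δ[l] ⟶ Δ[k - 1] ⋆ Δ[0] = Δ[k]` collapsing `Δ[l]` to a point. -/
def collapse (k : ℕ) (l : SimplexCategory) : (shift k).obj l ⟶ ⦋k⦌ :=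
  (shift k).map (SimplexCategory.const l ⦋0⦌ 0)

variable {C : Type u} [Category.{v} C]

/-- The simplicial object `X^{Δ[k - 1] ⋆}`, with `l`-simplices `X_{k + l}`. -/
def dec (k : ℕ) (X : SimplicialObject C) : SimplicialObject C := (shift k).op ⋙ X

/-- The relative higher morphism space `P^{≥ k}(f)`: the pullback of
`X^{Δ[k-1] ⋆} ⟶ X^{∂Δ[k-1] ⋆} ×_{Y^{∂Δ[k-1] ⋆}} Y^{Δ[k-1] ⋆}` along the map from the constant
simplicial object `Λ^k_k(f)`. A section over `T` in degree `l` is an `x : T ⟶ X_{k + l}` such that,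
for some section `z` of `Λ^k_k(f)`, the restriction of `x` to `∂Δ[k - 1] ⋆ Δ[l]` (the preimage of
`Λ[k, k]` under the collapse map) and the image of `x` in `Y_{k + l}` are both pulled back from `z`
along the collapse map. Such a `z` is unique, as the collapse map has a section. -/
def IsRelMorphism (k : ℕ) {X Y : SimplicialObject C} (f : X ⟶ Y) (l : SimplexCategory) {T : C}
    (x : T ⟶ (dec k X).obj (op l)) : Prop :=
  ∃ z : RelFamily f (SSet.horn.{0} k (Fin.last k)) T,
    (∀ (m : SimplexCategory) (α : m ⟶ (shift k).obj l)
      (h : SSet.stdSimplex.objEquiv.symm (α ≫ collapse k l) ∈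
        (SSet.horn.{0} k (Fin.last k)).obj (op m)),
      x ≫ X.map α.op = z.app m (α ≫ collapse k l) h) ∧
    x ≫ f.app (op ((shift k).obj l)) = z.base ≫ Y.map (collapse k l).op

/-- The simplicial object `P^{≥ k}(f)` in `C`; it need not exist in general. -/
structure MorphismSpace (k : ℕ) {X Y : SimplicialObject C} (f : X ⟶ Y) where
  obj : SimplicialObject C
  incl : obj ⟶ dec k X
  isRelMorphism : ∀ l : SimplexCategory, IsRelMorphism k f l (incl.app (op l))
  existsUnique : ∀ (l : SimplexCategory) (T : C) (x : T ⟶ (dec k X).obj (op l)),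
    IsRelMorphism k f l x → ∃! p : T ⟶ obj.obj (op l), p ≫ incl.app (op l) = x

/-- `X --q--> τ --t--> Y` exhibits `t` as the `n`-strictification `τ_n(f) : τ_n(X, f) ⟶ Y` of
`f : X ⟶ Y`. -/
structure IsStrictification (W : MorphismProperty C) (n : ℕ) {X Y τ : SimplicialObject C}
    (f : X ⟶ Y) (q : X ⟶ τ) (t : τ ⟶ Y) : Prop where
  fac : q ≫ t = f
  /-- For `k < n`, the `k`-simplices are those of `X`. -/
  isIso_of_lt : ∀ k : ℕ, k < n → IsIso (q.app (op ⦋k⦌))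
  /-- The object of `n`-simplices is the orbit space of `P^{≥ n}(f)`, a quotient of
  `P^{≥ n}(f)_0 = X_n`. -/
  orbit : ∃ P : MorphismSpace n f,
    IsOrbitSpace W P.obj ((P.incl.app (op ⦋0⦌) : P.obj _⦋0⦌ ⟶ X _⦋n⦌) ≫ q.app (op ⦋n⦌))
  /-- The object of `(n + 1)`-simplices is the object of relative horns `Λ^{n+1}_1(t)`. -/
  horn : ∃ L : RelLimit t (SSet.horn.{0} (n + 1) 1), IsIso L.comparison
  /-- In degree `k`, `τ` is the limit of `Csk_{n+1}(τ) ⟶ Csk_{n+1}(Y) ⟵ Y`, where the `k`-simplices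
  of `Csk_{n+1}` are the maps out of the `(n + 1)`-skeleton of `Δ[k]`
  (`SSet.skeleton _ (n + 2)` is generated by the simplices of dimension `< n + 2`). -/
  coskeletal : ∀ k : ℕ,
    ∃ L : RelLimit t (SSet.skeleton (Δ[k] : SSet.{0}) (n + 2)), IsIso L.comparison

end Join

section Lie

variable {C : Type u} [Category.{v} C] [CartesianMonoidalCategory C]

/-- The map from a simplicial object to the terminal one. -/
def toPoint (X : SimplicialObject C) : X ⟶ (SimplicialObject.const C).obj (𝟙_ C) where
  app m := toUnit (X.obj m)

/-- Lie `n`-groupoids, for `n ∈ ℕ ∪ {∞}`: for all `k > 0` and all `i`, the limit `Λ^k_i(X)` exists,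
and the map `λ^k_i(X)` is a cover, and an isomorphism if `k > n`. -/
def IsLieGroupoid (W : MorphismProperty C) (n : ℕ∞) (X : SimplicialObject C) : Prop :=
  ∀ (k : ℕ) (i : Fin (k + 1)), 0 < k →
    ∃ L : RelLimit (toPoint X) (SSet.horn.{0} k i),
      W L.comparison ∧ (n < k → IsIso L.comparison)

/-- `n`-hypercovers of Lie `∞`-groupoids, for `n ∈ ℕ ∪ {∞}`: for all `k`, the matching object
`M_k(f)` exists, and the map `μ_k(f)` is a cover, and an isomorphism if `k ≥ n`.
A hypercover is an `∞`-hypercover. -/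
structure IsHypercover (W : MorphismProperty C) (n : ℕ∞) {X Y : SimplicialObject C} (f : X ⟶ Y) :
    Prop where
  source : IsLieGroupoid W ⊤ X
  target : IsLieGroupoid W ⊤ Y
  matching : ∀ k : ℕ, ∃ L : RelLimit f (SSet.boundary.{0} k),
    W L.comparison ∧ (n ≤ k → IsIso L.comparison)

/-- The simplicial operator of the nerve of a group `H`: `θ : [m] ⟶ [k]` sends `(g_0, …, g_{k-1})`
to the family with `j`-th entry `g_{θ(j)} g_{θ(j) + 1} ⋯ g_{θ(j + 1) - 1}`, written as a quotient
of two of the partial products `1, g_0, g_0 g_1, …`. -/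
def nerveAct {H : Type*} [Group H] {m k : ℕ} (θ : Fin (m + 1) →o Fin (k + 1)) (g : Fin k → H) :
    Fin m → H :=
  fun j => (Fin.partialProd g (θ j.castSucc))⁻¹ * Fin.partialProd g (θ j.succ)

lemma partialProd_nerveAct {H : Type*} [Group H] {m k : ℕ} (θ : Fin (m + 1) →o Fin (k + 1))
    (g : Fin k → H) (i : Fin (m + 1)) :
    Fin.partialProd (nerveAct θ g) i =
      (Fin.partialProd g (θ 0))⁻¹ * Fin.partialProd g (θ i) := by
  induction i using Fin.induction with
  | zero => simp
  | succ i ih => rw [Fin.partialProd_succ, ih, nerveAct]; group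

lemma nerveAct_id {H : Type*} [Group H] {k : ℕ} (g : Fin k → H) :
    nerveAct OrderHom.id g = g := by
  funext j
  exact Fin.partialProd_right_inv g j

lemma nerveAct_comp {H : Type*} [Group H] {l m k : ℕ} (ξ : Fin (l + 1) →o Fin (m + 1))
    (θ : Fin (m + 1) →o Fin (k + 1)) (g : Fin k → H) :
    nerveAct ξ (nerveAct θ g) = nerveAct (θ.comp ξ) g := by
  funext j
  simp only [nerveAct, partialProd_nerveAct, OrderHom.comp_coe, Function.comp]
  group

lemma comp_partialProd {G : C} [GrpObj G] {T T' : C} (h : T' ⟶ T) {k : ℕ} (g : Fin k → (T ⟶ G))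
    (i : Fin (k + 1)) :
    h ≫ Fin.partialProd g i = Fin.partialProd (fun a => h ≫ g a) i := by
  induction i using Fin.induction with
  | zero => simp [MonObj.comp_one]
  | succ i ih => rw [Fin.partialProd_succ, Fin.partialProd_succ, MonObj.comp_mul, ih]

lemma comp_nerveAct {G : C} [GrpObj G] {T T' : C} (h : T' ⟶ T) {m k : ℕ}
    (θ : Fin (m + 1) →o Fin (k + 1)) (g : Fin k → (T ⟶ G)) (j : Fin m) :
    h ≫ nerveAct θ g j = nerveAct θ (fun a => h ≫ g a) j := by
  simp only [nerveAct, MonObj.comp_mul, GrpObj.comp_inv, comp_partialProd]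

/-- The nerve `W̄ G` of a Lie group `G` (a group object of `C`, regarded as a constant simplicial
group): `W̄_k G = G ^ k`, with inner faces given by multiplication of adjacent factors, outer faces
by omission of the first or last factor, and degeneracies by insertion of the unit. -/
noncomputable def Wbar (G : C) [GrpObj G] : SimplicialObject C where
  obj k := ∏ᶜ fun _ : Fin k.unop.len => G
  map θ := Pi.lift fun j => nerveAct θ.unop.toOrderHom (fun i => Pi.π (fun _ => G) i) j
  map_id k := by
    refine Pi.hom_ext _ _ fun j => ?_
    rw [Pi.lift_π, Category.id_comp]
    exact congrFun (nerveAct_id _) j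
  map_comp θ ξ := by
    refine Pi.hom_ext _ _ fun j => ?_
    rw [Category.assoc, Pi.lift_π, Pi.lift_π, comp_nerveAct]
    simp only [Pi.lift_π]
    exact (congrFun (nerveAct_comp _ _ _) j).symm

/-- The surjective monotone maps `[k] ⟶ [n]`. -/
abbrev Surj (k n : ℕ) : Type :=
  {σ : Fin (k + 1) →o Fin (n + 1) // Function.Surjective σ}

noncomputable instance (k n : ℕ) : Fintype (Surj k n) :=
  @Fintype.ofFinite _ (Finite.of_injective (fun σ : Surj k n => (σ.1 : Fin (k + 1) → Fin (n + 1)))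
    (fun _ _ h => Subtype.ext (DFunLike.coe_injective h)))

open Classical in
/-- The simplicial operator of the Eilenberg-MacLane simplicial abelian group `K(B, n)` (written
multiplicatively), which the Dold-Kan correspondence assigns to the complex `B` concentrated in
degree `n`: `θ : [m] ⟶ [k]` sends `(x_σ)`, indexed by the surjections `σ : [k] ⟶ [n]`, to the family
whose entry at `τ` is the product of the `x_σ` over all `σ` with `σ ∘ θ = τ`. -/
noncomputable def emAct {B : Type*} [CommMonoid B] (n : ℕ) {m k : ℕ}
    (θ : Fin (m + 1) →o Fin (k + 1)) (x : Surj k n → B) : Surj m n → B :=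
  fun τ => ∏ σ : Surj k n, if σ.1.comp θ = τ.1 then x σ else 1

lemma emAct_id {B : Type*} [CommMonoid B] (n : ℕ) {k : ℕ} (x : Surj k n → B) :
    emAct n OrderHom.id x = x := by
  classical
  funext τ
  rw [emAct, Finset.prod_eq_single τ]
  · exact if_pos rfl
  · intro σ _ hσ
    exact if_neg fun h => hσ (Subtype.ext h)
  · simp

lemma emAct_comp {B : Type*} [CommMonoid B] (n : ℕ) {l m k : ℕ} (ξ : Fin (l + 1) →o Fin (m + 1))
    (θ : Fin (m + 1) →o Fin (k + 1)) (x : Surj k n → B) :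
    emAct n ξ (emAct n θ x) = emAct n (θ.comp ξ) x := by
  classical
  funext ρ
  have key : ∀ σ : Surj k n, (∏ τ : Surj m n, if τ.1.comp ξ = ρ.1 then
      (if σ.1.comp θ = τ.1 then x σ else 1) else 1) =
      if σ.1.comp (θ.comp ξ) = ρ.1 then x σ else 1 := by
    intro σ
    by_cases h : σ.1.comp (θ.comp ξ) = ρ.1
    · have hs : Function.Surjective (σ.1.comp θ) := by
        intro y
        obtain ⟨a, ha⟩ := ρ.2 y
        exact ⟨ξ a, by rw [← ha, ← h]; rfl⟩
      rw [Finset.prod_eq_single ⟨σ.1.comp θ, hs⟩, if_pos h, if_pos, if_pos rfl]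
      · exact h
      · intro τ _ hτ
        have : σ.1.comp θ ≠ τ.1 := fun e => hτ (Subtype.ext e.symm)
        simp [this]
      · simp
    · rw [if_neg h]
      refine Finset.prod_eq_one fun τ _ => ?_
      split_ifs with h1 h2
      · exact absurd (by rw [← h1, ← h2]; rfl) h
      · rfl
      · rfl
  calc emAct n ξ (emAct n θ x) ρ
      = ∏ τ : Surj m n, ∏ σ : Surj k n, if τ.1.comp ξ = ρ.1 then
          (if σ.1.comp θ = τ.1 then x σ else 1) else 1 := by
        refine Finset.prod_congr rfl fun τ _ => ?_
        by_cases h : τ.1.comp ξ = ρ.1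
        · simp only [if_pos h]; rfl
        · simp only [if_neg h, Finset.prod_const_one]
    _ = ∏ σ : Surj k n, ∏ τ : Surj m n, if τ.1.comp ξ = ρ.1 then
          (if σ.1.comp θ = τ.1 then x σ else 1) else 1 := Finset.prod_comm
    _ = _ := Finset.prod_congr rfl fun σ _ => key σ

variable [BraidedCategory C]

lemma comp_emAct {A : C} [GrpObj A] [IsCommMonObj A] {T T' : C} (h : T' ⟶ T) (n : ℕ) {m k : ℕ}
    (θ : Fin (m + 1) →o Fin (k + 1)) (x : Surj k n → (T ⟶ A)) (τ : Surj m n) :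
    h ≫ emAct n θ x τ = emAct n θ (fun a => h ≫ x a) τ := by
  classical
  let φ : (T ⟶ A) →* (T' ⟶ A) :=
    { toFun := fun g => h ≫ g
      map_one' := MonObj.comp_one h
      map_mul' := MonObj.comp_mul h }
  have : φ (emAct n θ x τ) = emAct n θ (fun a => φ (x a)) τ := by
    simp only [emAct, map_prod]
    refine Finset.prod_congr rfl fun σ _ => ?_
    split_ifs
    · rfl
    · exact map_one φ
  exact this

/-- The Eilenberg-MacLane object `K(A, n)` of an abelian Lie group `A` (a commutative group object
of `C`): `K(A, n)_k` is the product of copies of `A` indexed by the surjections `[k] ⟶ [n]`. -/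
noncomputable def EilenbergMacLane (A : C) [GrpObj A] [IsCommMonObj A] (n : ℕ) :
    SimplicialObject C where
  obj k := ∏ᶜ fun _ : Surj k.unop.len n => A
  map θ := Pi.lift fun τ => emAct n θ.unop.toOrderHom (fun σ => Pi.π (fun _ => A) σ) τ
  map_id k := by
    refine Pi.hom_ext _ _ fun j => ?_
    rw [Pi.lift_π, Category.id_comp]
    exact congrFun (emAct_id n _) j
  map_comp θ ξ := by
    refine Pi.hom_ext _ _ fun j => ?_
    rw [Category.assoc, Pi.lift_π, Pi.lift_π, comp_emAct]
    simp only [Pi.lift_π]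
    exact (congrFun (emAct_comp n _ _ _) j).symm

/-- An `A`-valued `n`-cocycle on `W̄ G`: a span `W̄ G ⟵ U ⟶ K(A, n)` whose left leg `f` is a
hypercover. -/
structure Cocycle (W : MorphismProperty C) (G A : C) [GrpObj G] [GrpObj A] [IsCommMonObj A]
    (n : ℕ) where
  U : SimplicialObject C
  f : U ⟶ Wbar G
  φ : U ⟶ EilenbergMacLane A n
  isHypercover : IsHypercover W ⊤ f

/-- The commuting diagram of cocycles with maps `a₀ : V ⟶ U⁰` and `a₁ : V ⟶ U¹` is an equivalence
of the cocycles `U⁰` and `U¹`. -/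
structure IsEquivalence {W : MorphismProperty C} {G A : C} [GrpObj G] [GrpObj A] [IsCommMonObj A]
    {n : ℕ} (c₀ c₁ V : Cocycle W G A n) (a₀ : V.U ⟶ c₀.U) (a₁ : V.U ⟶ c₁.U) : Prop where
  comm_f₀ : a₀ ≫ c₀.f = V.f
  comm_φ₀ : a₀ ≫ c₀.φ = V.φ
  comm_f₁ : a₁ ≫ c₁.f = V.f
  comm_φ₁ : a₁ ≫ c₁.φ = V.φ
  isHypercover₀ : IsHypercover W ⊤ a₀
  isHypercover₁ : IsHypercover W ⊤ a₁

end Lie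

end LieStack

/-! For a hypercover `f : X ⟶ Y` the orbit space of `P^{≥ n}(f)` is the matching object `M_n(f)`.
Homotopic `n`-simplices have the same boundary and the same image in `Y`. Conversely, two
`n`-simplices with the same boundary and image are two adjacent faces of a map out of `∂Δ[n + 1]`
whose other faces are degenerate; as `μ_{n+1}(f)` is a cover, this map is filled after passing to a
cover of the parameter object (`exists_homotopy`, `MorphismSpace.isOrbitSpace`).

Hence a strictification is the relative `(n - 1)`-coskeleton of `f`: its `k`-simplices are
compatible families in `X` on the `(n - 1)`-skeleton of `Δ[k]` together with a `k`-simplex of `Y`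
extending their image. For existence this object is written down (`relCosk`). For an arbitrary
strictification the description holds in degree `n` by the orbit space condition and propagates
upwards through the conditions on horns and skeleta (`IsStrictification.isCoskeletal`).

All limits involved exist because enlarging a sieve by one simplex is a base change of some
`μ_m(f)`; the same argument shows that restriction of families is a cover (`Lim.exists_extend`).
With `q : X ⟶ Z` and `t : Z ⟶ Y` the two legs, `μ_k(t)` is `μ_k(f)` for `k < n` and invertible for
`k ≥ n`, whereas `μ_k(q)` is invertible for `k < n` and is `μ_k(f)` for `k ≥ n`. So both are
hypercovers, once `Z` is known to be a Lie `∞`-groupoid (`HasMatching.isLieGroupoid`).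

Each `q_k` is then a cover, hence an effective epimorphism, and `φ` descends along `q` as soon as it
respects the fibres of `q_k`. Simplices of `K(A, n)` are determined by their `n`-dimensional faces
(`eq_of_emAct_eq`), which reduces this to homotopic `n`-simplices. For a homotopy `h`, all `n`-faces
of `φ(h)` except two come from simplices of dimension `< n`, where `K(A, n)` is trivial, and the
cocycle relation makes the two remaining faces equal (`IsRelMor.comp_em_eq`). -/

namespace LieStack

/-! ### Sieves on simplices: subcomplexes, skeleta, boundaries -/

section Sieves

/-- The sieve of simplices of a subcomplex of a standard simplex. -/
def sieveOf {k : SimplexCategory} (S : (SSet.stdSimplex.{0}.obj k).Subcomplex) : Sieve k where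
  arrows m α := SSet.stdSimplex.objEquiv.symm α ∈ S.obj (op m)
  downward_closed h θ := S.map θ.op h

/-- The sieve of simplices factoring through a simplex of dimension `< n`. -/
def skSieve (n : ℕ) (k : SimplexCategory) : Sieve k where
  arrows m α := ∃ (p : SimplexCategory) (σ : m ⟶ p) (β : p ⟶ k), p.len < n ∧ σ ≫ β = α
  downward_closed := by
    rintro m m' α ⟨p, σ, β, hp, rfl⟩ θ
    exact ⟨p, θ ≫ σ, β, hp, by simp⟩

/-- The sieve of non-surjective maps. -/
def bdSieve (k : SimplexCategory) : Sieve k where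
  arrows m α := ¬ Function.Surjective α.toOrderHom
  downward_closed h θ h' := h (Function.Surjective.of_comp (g := θ.toOrderHom) h')

lemma sieveOf_skeleton (n k : ℕ) : sieveOf (SSet.skeleton (Δ[k] : SSet.{0}) n) = skSieve n ⦋k⦌ := by
  ext m α
  constructor
  · intro h
    change SSet.stdSimplex.objEquiv.symm α ∈ _ at h
    erw [SSet.skeleton, OrderHom.coe_mk, Subfunctor.iSup_obj] at h
    simp only [Subfunctor.iSup_obj, Set.mem_iUnion] at h
    obtain ⟨⟨i, hi⟩, y, ⟨θ, hθ⟩⟩ := h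
    exact ⟨⦋i⦌, θ.unop, SSet.stdSimplex.objEquiv y.1, hi,
      SSet.stdSimplex.objEquiv.symm.injective hθ⟩
  · rintro ⟨p, σ, β, hp, rfl⟩
    induction p using SimplexCategory.rec with | _ p =>
    exact (SSet.skeleton (Δ[k] : SSet.{0}) n).map σ.op
      (SSet.mem_skeleton _ (SSet.stdSimplex.objEquiv.symm β) hp)

lemma skSieve_of_len_lt {n : ℕ} {m k : SimplexCategory} (α : m ⟶ k) (h : m.len < n) :
    skSieve n k α := ⟨m, 𝟙 m, α, h, by simp⟩

lemma skSieve_of_le {n n' : ℕ} (h : n ≤ n') (k : SimplexCategory) : skSieve n k ≤ skSieve n' k := by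
  rintro m α ⟨p, σ, β, hp, rfl⟩
  exact ⟨p, σ, β, hp.trans_le h, rfl⟩

lemma skSieve_eq_top {n : ℕ} {k : SimplexCategory} (h : k.len < n) : skSieve n k = ⊤ :=
  top_le_iff.1 fun m α _ => ⟨k, α, 𝟙 k, h, by simp⟩

lemma skSieve_comp (n : ℕ) {m k k' : SimplexCategory} (θ : k' ⟶ k) (α : m ⟶ k')
    (h : skSieve n k' α) : skSieve n k (α ≫ θ) := by
  obtain ⟨p, σ, β, hp, rfl⟩ := h
  exact ⟨p, σ, β ≫ θ, hp, by simp⟩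

lemma skSieve_le_bdSieve {n : ℕ} {k : SimplexCategory} (h : n ≤ k.len) :
    skSieve n k ≤ bdSieve k := by
  rintro m _ ⟨p, σ, β, hp, rfl⟩ hs
  have hβ : Function.Surjective β.toOrderHom := by
    intro x
    obtain ⟨y, hy⟩ := hs x
    exact ⟨σ.toOrderHom y, hy⟩
  have := SimplexCategory.epi_iff_surjective.2 hβ
  have := SimplexCategory.len_le_of_epi β
  omega

/-- The epi-mono factorization in the simplex category, with a section of the epimorphism. -/
lemma exists_factorization {m k : SimplexCategory} (α : m ⟶ k) :
    ∃ (p : SimplexCategory) (e : m ⟶ p) (s : p ⟶ m) (i : p ⟶ k), s ≫ e = 𝟙 p ∧ Mono i ∧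
      e ≫ i = α :=
  have := isSplitEpi_of_epi (factorThruImage α)
  ⟨image α, factorThruImage α, section_ (factorThruImage α), image.ι α,
    IsSplitEpi.id _, inferInstance, image.fac α⟩

/-- A map that is not surjective has an image of strictly smaller dimension. -/
lemma bdSieve_le_skSieve (k : SimplexCategory) : bdSieve k ≤ skSieve k.len k := by
  intro m α hα
  obtain ⟨p, e, s, i, hs, hi, rfl⟩ := exists_factorization α
  refine ⟨p, e, i, ?_, rfl⟩
  refine lt_of_le_of_ne (SimplexCategory.len_le_of_mono i) fun h => hα ?_
  have : IsIso i := (SimplexCategory.isIso_iff_of_mono i).2 h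
  have h2 : Epi e := ⟨fun a b hab => by
    rw [← Category.id_comp a, ← hs, Category.assoc, hab, ← Category.assoc, hs, Category.id_comp]⟩
  exact SimplexCategory.epi_iff_surjective.1 (epi_comp e i)

lemma skSieve_len (k : SimplexCategory) : skSieve k.len k = bdSieve k :=
  le_antisymm (skSieve_le_bdSieve le_rfl) (bdSieve_le_skSieve k)

/-- At most `n` vertices, together with the vertex `i`, cannot exhaust the `k + 1 > n + 1` vertices
of `Δ[k]`. -/
lemma skSieve_le_horn (n k : ℕ) (i : Fin (k + 1)) (h : n < k) :
    skSieve n ⦋k⦌ ≤ sieveOf (SSet.horn.{0} k i) := by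
  rintro m _ ⟨p, σ, β, hp, rfl⟩ hu
  have h1 : (Finset.image β.toOrderHom Finset.univ ∪ {i}) = Finset.univ := by
    refine Finset.eq_univ_iff_forall.2 fun x => ?_
    have := Set.eq_univ_iff_forall.1 hu x
    simp only [Finset.mem_union, Finset.mem_image, Finset.mem_univ, true_and,
      Finset.mem_singleton]
    rcases this with ⟨y, hy⟩ | hx
    · exact Or.inl ⟨σ.toOrderHom y, hy⟩
    · exact Or.inr hx
  have h2 := congrArg Finset.card h1
  have h3 := Finset.card_union_le (Finset.image β.toOrderHom Finset.univ) {i}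
  have h4 : (Finset.image β.toOrderHom Finset.univ).card ≤ p.len + 1 := by
    simpa using Finset.card_image_le (s := Finset.univ) (f := β.toOrderHom)
  rw [h2] at h3
  simp at h3
  omega

end Sieves

/-! ### Compatible families and the limits representing them -/

section Families

variable {C : Type u} [Category.{v} C]

/-- A compatible family of maps from `T` to `X`, indexed by the sieve `P`, and to `Y`, indexed by
the sieve `Q`: a section over `T` of `hom(P, X) ×_{hom(P, Y)} hom(Q, Y)` if `P ≤ Q`. -/
structure Family {X Y : SimplicialObject C} (f : X ⟶ Y) {k : SimplexCategory}
    (P Q : Sieve k) (T : C) where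
  app : ∀ {m : SimplexCategory} (α : m ⟶ k), P α → (T ⟶ X.obj (op m))
  base : ∀ {m : SimplexCategory} (α : m ⟶ k), Q α → (T ⟶ Y.obj (op m))
  app_map : ∀ {m m' : SimplexCategory} (θ : m' ⟶ m) (α : m ⟶ k) (h : P α),
    app α h ≫ X.map θ.op = app (θ ≫ α) (P.downward_closed h θ)
  base_map : ∀ {m m' : SimplexCategory} (θ : m' ⟶ m) (α : m ⟶ k) (h : Q α),
    base α h ≫ Y.map θ.op = base (θ ≫ α) (Q.downward_closed h θ)
  app_comp : ∀ {m : SimplexCategory} (α : m ⟶ k) (h : P α) (h' : Q α),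
    app α h ≫ f.app (op m) = base α h'

namespace Family

variable {X Y Z : SimplicialObject C} {f : X ⟶ Y} {k : SimplexCategory} {P Q P' Q' : Sieve k}
  {T T' : C}

lemma ext {d d' : Family f P Q T} (h : ∀ {m} (α : m ⟶ k) (hα : P α), d.app α hα = d'.app α hα)
    (h' : ∀ {m} (α : m ⟶ k) (hα : Q α), d.base α hα = d'.base α hα) : d = d' := by
  obtain ⟨a, b, _, _, _⟩ := d
  obtain ⟨a', b', _, _, _⟩ := d'
  have h1 : @a = @a' := by funext m α hα; exact h α hα
  have h2 : @b = @b' := by funext m α hα; exact h' α hα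
  subst h1 h2
  rfl

lemma app_congr (d : Family f P Q T) {m} {α β : m ⟶ k} (h : α = β) (hα : P α) :
    d.app α hα = d.app β (h ▸ hα) := by subst h; rfl

lemma base_congr (d : Family f P Q T) {m} {α β : m ⟶ k} (h : α = β) (hα : Q α) :
    d.base α hα = d.base β (h ▸ hα) := by subst h; rfl

/-- Restriction along a map `g : T' ⟶ T`. -/
def precomp (d : Family f P Q T) (g : T' ⟶ T) : Family f P Q T' where
  app α h := g ≫ d.app α h
  base α h := g ≫ d.base α h
  app_map θ α h := by rw [Category.assoc, d.app_map]
  base_map θ α h := by rw [Category.assoc, d.base_map]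
  app_comp α h h' := by rw [Category.assoc, d.app_comp α h h']

@[simp] lemma precomp_app (d : Family f P Q T) (g : T' ⟶ T) {m} (α : m ⟶ k) (h : P α) :
    (d.precomp g).app α h = g ≫ d.app α h := rfl

@[simp] lemma precomp_base (d : Family f P Q T) (g : T' ⟶ T) {m} (α : m ⟶ k) (h : Q α) :
    (d.precomp g).base α h = g ≫ d.base α h := rfl

lemma precomp_precomp {T'' : C} (d : Family f P Q T) (g : T' ⟶ T) (g' : T'' ⟶ T') :
    (d.precomp g).precomp g' = d.precomp (g' ≫ g) :=
  ext (fun _ _ => by simp) (fun _ _ => by simp)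

lemma precomp_id (d : Family f P Q T) : d.precomp (𝟙 T) = d :=
  ext (fun _ _ => by simp) (fun _ _ => by simp)

lemma ext_of_epi (g : T' ⟶ T) [Epi g] {d d' : Family f P Q T} (h : d.precomp g = d'.precomp g) :
    d = d' := by
  refine ext (fun α hα => ?_) (fun α hα => ?_)
  · rw [← cancel_epi g, ← precomp_app, h, precomp_app]
  · rw [← cancel_epi g, ← precomp_base, h, precomp_base]

/-- Restriction to smaller sieves. -/
def restrict (d : Family f P Q T) (hP : P' ≤ P) (hQ : Q' ≤ Q) : Family f P' Q' T where
  app α h := d.app α (hP _ h)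
  base α h := d.base α (hQ _ h)
  app_map θ α h := d.app_map θ α _
  base_map θ α h := d.base_map θ α _
  app_comp α h h' := d.app_comp α _ _

@[simp] lemma restrict_app (d : Family f P Q T) (hP : P' ≤ P) (hQ : Q' ≤ Q) {m} (α : m ⟶ k)
    (h : P' α) : (d.restrict hP hQ).app α h = d.app α (hP _ h) := rfl

@[simp] lemma restrict_base (d : Family f P Q T) (hP : P' ≤ P) (hQ : Q' ≤ Q) {m} (α : m ⟶ k)
    (h : Q' α) : (d.restrict hP hQ).base α h = d.base α (hQ _ h) := rfl

/-- Pullback along a map of simplices. -/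
def pull (d : Family f P Q T) {k' : SimplexCategory} (θ : k' ⟶ k) {P' Q' : Sieve k'}
    (hP : ∀ {m} (α : m ⟶ k'), P' α → P (α ≫ θ)) (hQ : ∀ {m} (α : m ⟶ k'), Q' α → Q (α ≫ θ)) : Family f P' Q' T where
  app α h := d.app (α ≫ θ) (hP α h)
  base α h := d.base (α ≫ θ) (hQ α h)
  app_map ξ α h := (d.app_map ξ _ _).trans (d.app_congr (Category.assoc _ _ _).symm _)
  base_map ξ α h := (d.base_map ξ _ _).trans (d.base_congr (Category.assoc _ _ _).symm _)
  app_comp α h h' := d.app_comp _ _ _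

@[simp] lemma pull_app (d : Family f P Q T) {k' : SimplexCategory} (θ : k' ⟶ k) {P' Q' : Sieve k'}
    (hP : ∀ {m} (α : m ⟶ k'), P' α → P (α ≫ θ)) (hQ : ∀ {m} (α : m ⟶ k'), Q' α → Q (α ≫ θ)) {m} (α : m ⟶ k') (h : P' α) :
    (d.pull θ hP hQ).app α h = d.app (α ≫ θ) (hP α h) := rfl

@[simp] lemma pull_base (d : Family f P Q T) {k' : SimplexCategory} (θ : k' ⟶ k) {P' Q' : Sieve k'}
    (hP : ∀ {m} (α : m ⟶ k'), P' α → P (α ≫ θ)) (hQ : ∀ {m} (α : m ⟶ k'), Q' α → Q (α ≫ θ)) {m} (α : m ⟶ k') (h : Q' α) :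
    (d.pull θ hP hQ).base α h = d.base (α ≫ θ) (hQ α h) := rfl

lemma precomp_restrict (d : Family f P Q T) (g : T' ⟶ T) (hP : P' ≤ P) (hQ : Q' ≤ Q) :
    (d.precomp g).restrict hP hQ = (d.restrict hP hQ).precomp g := rfl

/-- The image of a family under a map over `Y`. -/
def push (d : Family f P Q T) (q : X ⟶ Z) (t : Z ⟶ Y) (w : q ≫ t = f) : Family t P Q T where
  app {m} α h := d.app α h ≫ q.app (op m)
  base α h := d.base α h
  app_map θ α h := by rw [Category.assoc, ← q.naturality, ← Category.assoc, d.app_map]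
  base_map θ α h := d.base_map θ α h
  app_comp α h h' := by rw [Category.assoc, ← NatTrans.comp_app, w, d.app_comp α h h']

@[simp] lemma push_app (d : Family f P Q T) (q : X ⟶ Z) (t : Z ⟶ Y) (w : q ≫ t = f) {m} (α : m ⟶ k)
    (h : P α) : (d.push q t w).app α h = d.app α h ≫ q.app (op m) := rfl

@[simp] lemma push_base (d : Family f P Q T) (q : X ⟶ Z) (t : Z ⟶ Y) (w : q ≫ t = f) {m} (α : m ⟶ k)
    (h : Q α) : (d.push q t w).base α h = d.base α h := rfl

lemma push_precomp (d : Family f P Q T) (q : X ⟶ Z) (t : Z ⟶ Y) (w : q ≫ t = f) (g : T' ⟶ T) :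
    (d.push q t w).precomp g = (d.precomp g).push q t w :=
  ext (fun _ _ => by simp) (fun _ _ => by simp)

variable (f P Q) in
/-- The family of faces of a simplex. -/
def ofSimplex (x : T ⟶ X.obj (op k)) : Family f P Q T where
  app α _ := x ≫ X.map α.op
  base α _ := x ≫ f.app _ ≫ Y.map α.op
  app_map θ α _ := by simp
  base_map θ α _ := by simp
  app_comp α _ _ := by simp

@[simp] lemma ofSimplex_app (x : T ⟶ X.obj (op k)) {m} (α : m ⟶ k) (h : P α) :
    (ofSimplex f P Q x).app α h = x ≫ X.map α.op := rfl

@[simp] lemma ofSimplex_base (x : T ⟶ X.obj (op k)) {m} (α : m ⟶ k) (h : Q α) :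
    (ofSimplex f P Q x).base α h = x ≫ f.app _ ≫ Y.map α.op := rfl

lemma ofSimplex_precomp (x : T ⟶ X.obj (op k)) (g : T' ⟶ T) :
    (ofSimplex f P Q x).precomp g = ofSimplex f P Q (g ≫ x) :=
  ext (fun _ _ => by simp) (fun _ _ => by simp)

lemma ofSimplex_push (x : T ⟶ X.obj (op k)) (q : X ⟶ Z) (t : Z ⟶ Y) (w : q ≫ t = f) :
    (ofSimplex f P Q x).push q t w = ofSimplex t P Q (x ≫ q.app _) :=
  ext (fun _ _ => by simp) (fun _ _ => by simp [← w])

lemma ofSimplex_pull (x : T ⟶ X.obj (op k)) {k' : SimplexCategory} (θ : k' ⟶ k)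
    {P' Q' : Sieve k'} (hP : ∀ {m} (α : m ⟶ k'), P' α → P (α ≫ θ)) (hQ : ∀ {m} (α : m ⟶ k'), Q' α → Q (α ≫ θ)) :
    (ofSimplex f P Q x).pull θ hP hQ = ofSimplex f P' Q' (x ≫ X.map θ.op) :=
  ext (fun _ _ => by simp [pull]) (fun _ _ => by simp [pull])

/-- The family associated with a relative section. -/
def ofRel {S : (SSet.stdSimplex.{0}.obj k).Subcomplex} (d : RelFamily f S T) :
    Family f (sieveOf S) ⊤ T where
  app {m} α h := d.app m α h
  base α _ := d.base ≫ Y.map α.op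
  app_map θ α h := d.app_map _ _ θ α _ _
  base_map θ α _ := by simp
  app_comp α h _ := d.app_comp _ α h

/-- The relative section associated with a family. -/
def toRel {S : (SSet.stdSimplex.{0}.obj k).Subcomplex} (d : Family f (sieveOf S) ⊤ T) :
    RelFamily f S T where
  app m α h := d.app α h
  base := d.base (𝟙 k) trivial
  app_map m m' θ α h h' := d.app_map θ α h
  app_comp m α h := by
    rw [d.app_comp α h trivial, d.base_map]
    exact d.base_congr (by simp) _

lemma toRel_ofRel {S : (SSet.stdSimplex.{0}.obj k).Subcomplex} (d : RelFamily f S T) :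
    (ofRel d).toRel = d := by
  ext
  · rfl
  · simp [toRel, ofRel]

lemma ofRel_toRel {S : (SSet.stdSimplex.{0}.obj k).Subcomplex} (d : Family f (sieveOf S) ⊤ T) :
    ofRel d.toRel = d := by
  refine ext (fun _ _ => rfl) (fun α hα => ?_)
  change d.base (𝟙 k) trivial ≫ Y.map α.op = _
  rw [d.base_map]
  exact d.base_congr (by simp) _

end Family

/-- The limit `hom(P, X) ×_{hom(P, Y)} hom(Q, Y)`. -/
structure Lim {X Y : SimplicialObject C} (f : X ⟶ Y) {k : SimplexCategory} (P Q : Sieve k) where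
  obj : C
  fam : Family f P Q obj
  existsUnique : ∀ (T : C) (d : Family f P Q T), ∃! g : T ⟶ obj, fam.precomp g = d

namespace Lim

variable {X Y : SimplicialObject C} {f : X ⟶ Y} {k : SimplexCategory} {P Q P' Q' : Sieve k}
  {T T' : C}

/-- The map classifying a family. -/
noncomputable def lift (L : Lim f P Q) (d : Family f P Q T) : T ⟶ L.obj :=
  (L.existsUnique T d).choose

lemma precomp_lift (L : Lim f P Q) (d : Family f P Q T) : L.fam.precomp (L.lift d) = d :=
  (L.existsUnique T d).choose_spec.1

lemma lift_app (L : Lim f P Q) (d : Family f P Q T) {m} (α : m ⟶ k) (h : P α) :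
    L.lift d ≫ L.fam.app α h = d.app α h := by
  rw [← Family.precomp_app, precomp_lift]

lemma lift_base (L : Lim f P Q) (d : Family f P Q T) {m} (α : m ⟶ k) (h : Q α) :
    L.lift d ≫ L.fam.base α h = d.base α h := by
  rw [← Family.precomp_base, precomp_lift]

lemma hom_ext (L : Lim f P Q) {a b : T ⟶ L.obj} (h : L.fam.precomp a = L.fam.precomp b) : a = b :=
  (L.existsUnique T _).unique h rfl

lemma hom_ext' (L : Lim f P Q) {a b : T ⟶ L.obj}
    (h : ∀ {m} (α : m ⟶ k) (hα : P α), a ≫ L.fam.app α hα = b ≫ L.fam.app α hα)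
    (h' : ∀ {m} (α : m ⟶ k) (hα : Q α), a ≫ L.fam.base α hα = b ≫ L.fam.base α hα) : a = b :=
  L.hom_ext (Family.ext h h')

lemma comp_lift (L : Lim f P Q) (d : Family f P Q T) (g : T' ⟶ T) :
    g ≫ L.lift d = L.lift (d.precomp g) :=
  L.hom_ext (by rw [← Family.precomp_precomp, precomp_lift, precomp_lift])

lemma lift_congr (L : Lim f P Q) {d d' : Family f P Q T} (h : d = d') : L.lift d = L.lift d' := by
  rw [h]

/-- Limits are unique. -/
noncomputable def iso (L L' : Lim f P Q) : L.obj ≅ L'.obj where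
  hom := L'.lift L.fam
  inv := L.lift L'.fam
  hom_inv_id := L.hom_ext (by rw [comp_lift, precomp_lift, precomp_lift, Family.precomp_id])
  inv_hom_id := L'.hom_ext (by rw [comp_lift, precomp_lift, precomp_lift, Family.precomp_id])

variable (f) in
/-- The simplices of `X` are the families indexed by the maximal sieve. -/
def ofTop (Q : Sieve k) : Lim f ⊤ Q where
  obj := X.obj (op k)
  fam := Family.ofSimplex f ⊤ Q (𝟙 _)
  existsUnique T d := by
    refine ⟨d.app (𝟙 k) trivial, ?_, ?_⟩
    · beta_reduce
      rw [Family.ofSimplex_precomp]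
      refine Family.ext (fun α hα => ?_) (fun α hα => ?_)
      · simp only [Category.comp_id, Family.ofSimplex_app]
        rw [d.app_map]
        exact d.app_congr (by simp) _
      · simp only [Category.comp_id, Family.ofSimplex_base]
        rw [← f.naturality, ← Category.assoc, d.app_map, d.app_comp _ _ (by simpa using hα)]
        exact d.base_congr (by simp) _
    · intro g hg
      have := congrArg (fun d => d.app (𝟙 k) trivial) hg
      simpa [Family.ofSimplex_precomp] using this

/-- The limit as an object of relative sections. -/
def toRelLimit {S : (SSet.stdSimplex.{0}.obj k).Subcomplex} (L : Lim f (sieveOf S) ⊤) :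
    RelLimit f S where
  obj := L.obj
  family := L.fam.toRel
  existsUnique T d := by
    obtain ⟨g, hg, hu⟩ := L.existsUnique T (Family.ofRel d)
    refine ⟨g, ?_, fun g' hg' => hu g' ?_⟩
    · rw [← Family.toRel_ofRel d, ← hg]; rfl
    · change L.fam.precomp g' = _
      rw [← hg', ← Family.ofRel_toRel (L.fam.precomp g')]; rfl

/-- The object of relative sections as a limit. -/
def ofRelLimit {S : (SSet.stdSimplex.{0}.obj k).Subcomplex} (L : RelLimit f S) :
    Lim f (sieveOf S) ⊤ where
  obj := L.obj
  fam := Family.ofRel L.family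
  existsUnique T d := by
    obtain ⟨g, hg, hu⟩ := L.existsUnique T d.toRel
    refine ⟨g, ?_, fun g' hg' => hu g' ?_⟩
    · rw [← Family.ofRel_toRel d, ← hg]
      exact Family.ext (fun _ _ => rfl) (fun _ _ => by simp [Family.ofRel, RelFamily.precomp])
    · change L.family.precomp g' = _
      rw [← hg', ← Family.toRel_ofRel (L.family.precomp g')]
      exact congrArg Family.toRel
        (Family.ext (fun _ _ => rfl) (fun _ _ => by simp [Family.ofRel, RelFamily.precomp]))

lemma toRelLimit_comparison {S : (SSet.stdSimplex.{0}.obj k).Subcomplex}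
    (L : Lim f (sieveOf S) ⊤) :
    L.toRelLimit.comparison = L.lift (Family.ofSimplex f _ _ (𝟙 _)) := by
  refine (L.toRelLimit.existsUnique _ (RelFamily.ofSimplex f S (𝟙 (X.obj (op k))))).unique
    (L.toRelLimit.existsUnique _ (RelFamily.ofSimplex f S (𝟙 (X.obj (op k))))).choose_spec.1 ?_
  change (L.fam.precomp _).toRel = _
  rw [precomp_lift]
  ext
  · rfl
  · simp [Family.toRel, RelFamily.ofSimplex]

lemma ofRelLimit_lift {S : (SSet.stdSimplex.{0}.obj k).Subcomplex} (L : RelLimit f S) :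
    (ofRelLimit L).lift (Family.ofSimplex f _ _ (𝟙 _)) = L.comparison := by
  refine (ofRelLimit L).hom_ext ?_
  rw [precomp_lift]
  have h : L.family.precomp L.comparison = _ :=
    (L.existsUnique _ (RelFamily.ofSimplex f S (𝟙 (X.obj (op k))))).choose_spec.1
  refine Family.ext (fun {m} α hα => ?_) (fun {m} α hα => ?_)
  · exact (congrArg (fun d => d.app m α hα) h).symm
  · have := congrArg RelFamily.base h
    simp only [RelFamily.precomp, RelFamily.ofSimplex, Category.id_comp] at this
    simp [ofRelLimit, Family.ofRel, reassoc_of% this]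

end Lim

end Families

/-! ### Attaching simplices: restriction of families is a cover -/

section Attach

variable {C : Type u} [Category.{v} C] {W : MorphismProperty C}
  {X Y : SimplicialObject C} {f : X ⟶ Y} {k : SimplexCategory} {P Q P' : Sieve k}

lemma surjective_iff_exists_section {m k : SimplexCategory} (ρ : m ⟶ k) :
    Function.Surjective ρ.toOrderHom ↔ ∃ s : k ⟶ m, s ≫ ρ = 𝟙 k := by
  constructor
  · intro h
    have := SimplexCategory.epi_iff_surjective.2 h
    have := isSplitEpi_of_epi ρ
    exact ⟨section_ ρ, IsSplitEpi.id ρ⟩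
  · rintro ⟨s, hs⟩ x
    exact ⟨s.toOrderHom x, by
      change (s ≫ ρ).toOrderHom x = x
      rw [hs]; rfl⟩

lemma bdSieve_iff {m k : SimplexCategory} (ρ : m ⟶ k) :
    bdSieve k ρ ↔ ¬ ∃ s : k ⟶ m, s ≫ ρ = 𝟙 k :=
  not_congr (surjective_iff_exists_section ρ)

/-- The matching objects of `f` exist, and the maps to them belong to `W`. -/
def HasMatching (W : MorphismProperty C) (f : X ⟶ Y) : Prop :=
  ∀ m : SimplexCategory, ∃ L : Lim f (bdSieve m) ⊤, W (L.lift (Family.ofSimplex f _ _ (𝟙 _)))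

section

variable {N M : C} {T : C} {m : SimplexCategory}

/-- Extension of a family by a simplex with the given boundary. -/
lemma Family.exists_attach (d : Family f P Q T) (α : m ⟶ k) [Mono α] (hα : ¬ P α) (hQ : Q α)
    (hP' : ∀ {m'} (β : m' ⟶ k), P' β ↔ P β ∨ ∃ ρ : m' ⟶ m, ρ ≫ α = β)
    (x : T ⟶ X.obj (op m)) (hxf : x ≫ f.app _ = d.base α hQ)
    (hx : ∀ {m'} (ρ : m' ⟶ m), bdSieve m ρ → ∀ h : P (ρ ≫ α), x ≫ X.map ρ.op = d.app (ρ ≫ α) h) :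
    ∃ d' : Family f P' Q T, d'.restrict (fun _ β h => (hP' β).2 (Or.inl h)) le_rfl = d ∧
      ∀ h, d'.app α h = x := by
  classical
  -- If `ρ ≫ α` lies in `P`, then `ρ` is in the boundary: a section of `ρ` would put `α` itself into
  -- `P`.
  have hx' : ∀ {m'} (ρ : m' ⟶ m) (h : P (ρ ≫ α)), x ≫ X.map ρ.op = d.app (ρ ≫ α) h := by
    intro m' ρ h
    refine hx ρ ((bdSieve_iff ρ).2 ?_) h
    rintro ⟨s, hs⟩
    apply hα
    have := P.downward_closed h s
    rwa [← Category.assoc, hs, Category.id_comp] at this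
  let a : ∀ {m'} (β : m' ⟶ k), P' β → (T ⟶ X.obj (op m')) := fun β h =>
    if hβ : P β then d.app β hβ else x ≫ X.map (((hP' β).1 h).resolve_left hβ).choose.op
  have a1 : ∀ {m'} (β : m' ⟶ k) (h : P' β) (hβ : P β), a β h = d.app β hβ := fun β h hβ =>
    dif_pos hβ
  have a2 : ∀ {m'} (β : m' ⟶ k) (h : P' β) (ρ : m' ⟶ m), ρ ≫ α = β → a β h = x ≫ X.map ρ.op := by
    rintro m' β h ρ rfl
    by_cases hβ : P (ρ ≫ α)
    · rw [a1 _ h hβ, hx' ρ hβ]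
    · have e : (((hP' (ρ ≫ α)).1 h).resolve_left hβ).choose = ρ := by
        rw [← cancel_mono α]
        exact (((hP' (ρ ≫ α)).1 h).resolve_left hβ).choose_spec
      change dite _ _ _ = _
      rw [dif_neg hβ, e]
  refine ⟨{ app := a, base := d.base, app_map := ?_, base_map := d.base_map, app_comp := ?_ },
    ?_, ?_⟩
  · intro m₁ m₂ θ β h
    rcases (hP' β).1 h with hβ | ⟨ρ, rfl⟩
    · rw [a1 β h hβ, a1 _ (P'.downward_closed h θ) (P.downward_closed hβ θ), d.app_map]
    · rw [a2 _ h ρ rfl, a2 _ (P'.downward_closed h θ) (θ ≫ ρ) (by simp)]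
      simp
  · intro m₁ β h h'
    rcases (hP' β).1 h with hβ | ⟨ρ, rfl⟩
    · rw [a1 β h hβ, d.app_comp]
    · rw [a2 _ h ρ rfl, Category.assoc, f.naturality, ← Category.assoc, hxf, d.base_map]
  · exact Family.ext (fun β h => a1 β ((hP' β).2 (Or.inl h)) h) (fun _ _ => rfl)
  · intro h
    change a α h = x
    rw [a2 α h (𝟙 m) (by simp)]
    simp

end

/-- Attaching one `m`-simplex along its boundary is a base change of `μ_m(f)`: the new limit is the
pullback of `X_m ⟶ M_m(f)` along the map that sends a family to its restriction to the boundary of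
`α`. -/
lemma Lim.exists_attach [CartesianMonoidalCategory C] (hW : IsCoverClass W) (hf : HasMatching W f)
    (L : Lim f P Q) {m : SimplexCategory} (α : m ⟶ k) [Mono α] (hα : ¬ P α) (hQ : Q α)
    (hbd : ∀ {m'} (ρ : m' ⟶ m), bdSieve m ρ → P (ρ ≫ α))
    (hP' : ∀ {m'} (β : m' ⟶ k), P' β ↔ P β ∨ ∃ ρ : m' ⟶ m, ρ ≫ α = β) :
    ∃ L' : Lim f P' Q,
      W (L.lift (L'.fam.restrict (fun _ β h => (hP' β).2 (Or.inl h)) le_rfl)) := by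
  obtain ⟨M, hM⟩ := hf m
  have := hW.isStableUnderBaseChange
  let b : Family f (bdSieve m) ⊤ L.obj :=
    L.fam.pull α hbd (fun ρ _ => Q.downward_closed hQ ρ)
  have := hW.hasPullback (M.lift (Family.ofSimplex f _ _ (𝟙 _))) (M.lift b) hM
  let x := pullback.fst (M.lift (Family.ofSimplex f _ _ (𝟙 _))) (M.lift b)
  let r := pullback.snd (M.lift (Family.ofSimplex f _ _ (𝟙 _))) (M.lift b)
  have hr : W r := MorphismProperty.pullback_snd _ _ hM
  have w : Family.ofSimplex f (bdSieve m) ⊤ x = b.precomp r := by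
    have h := pullback.condition (f := M.lift (Family.ofSimplex f _ _ (𝟙 _))) (g := M.lift b)
    rw [Lim.comp_lift, Lim.comp_lift, Family.ofSimplex_precomp, Category.comp_id] at h
    rw [← M.precomp_lift (Family.ofSimplex f (bdSieve m) ⊤ x), h, M.precomp_lift]
  obtain ⟨u, hu, hux⟩ := Family.exists_attach (L.fam.precomp r) α hα hQ hP' x
    (by
      have := congrArg (fun d => d.base (𝟙 m) trivial) w
      simp only [Family.ofSimplex_base, op_id, Y.map_id, Category.comp_id] at this
      rw [this]
      exact congrArg (r ≫ ·) (L.fam.base_congr (by simp) _))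
    (fun ρ hρ h => congrArg (fun d => d.app ρ hρ) w)
  have hPα : P' α := (hP' α).2 (Or.inr ⟨𝟙 m, by simp⟩)
  refine ⟨⟨_, u, fun T d => ?_⟩, ?_⟩
  · let g : T ⟶ L.obj := L.lift (d.restrict (fun _ β h => (hP' β).2 (Or.inl h)) le_rfl)
    have hg : L.fam.precomp g = d.restrict (fun _ β h => (hP' β).2 (Or.inl h)) le_rfl :=
      L.precomp_lift _
    have hcond : d.app α hPα ≫ M.lift (Family.ofSimplex f _ _ (𝟙 _)) = g ≫ M.lift b := by
      rw [Lim.comp_lift, Lim.comp_lift]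
      refine M.lift_congr (Family.ext (fun ρ hρ => ?_) (fun ρ hρ => ?_))
      · simp only [Family.precomp_app, Family.ofSimplex_app, Category.id_comp]
        rw [d.app_map]
        exact (congrArg (fun d => d.app (ρ ≫ α) (hbd ρ hρ)) hg).symm
      · simp only [Family.precomp_base, Family.ofSimplex_base, Category.id_comp]
        rw [← Category.assoc, d.app_comp α hPα hQ, d.base_map]
        exact (congrArg (fun d => d.base (ρ ≫ α) (Q.downward_closed hQ ρ)) hg).symm
    refine ⟨pullback.lift (d.app α hPα) g hcond, ?_, ?_⟩
    · have h1 : (u.precomp (pullback.lift (d.app α hPα) g hcond)).restrict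
          (fun _ β h => (hP' β).2 (Or.inl h)) le_rfl =
          d.restrict (fun _ β h => (hP' β).2 (Or.inl h)) le_rfl := by
        rw [Family.precomp_restrict, hu, Family.precomp_precomp, ← hg]
        congr 1
        exact pullback.lift_snd _ _ _
      refine Family.ext (fun β hβ => ?_) (fun β hβ => congrArg (fun d => d.base β hβ) h1)
      rcases (hP' β).1 hβ with h | ⟨ρ, rfl⟩
      · exact congrArg (fun d => d.app β h) h1
      · rw [← d.app_map ρ α hPα, ← Family.app_map _ ρ α hPα, Family.precomp_app, hux]
        congr 1
        exact pullback.lift_fst _ _ _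
    · intro g' hg'
      apply pullback.hom_ext
      · rw [pullback.lift_fst, ← hg', Family.precomp_app, hux]
      · rw [pullback.lift_snd]
        apply L.hom_ext
        rw [hg, ← Family.precomp_precomp]
        change (L.fam.precomp r).precomp g' = _
        rw [← hu, ← Family.precomp_restrict, hg']
  · have : L.lift (u.restrict (fun _ β h => (hP' β).2 (Or.inl h)) le_rfl) = r :=
      L.hom_ext (by rw [L.precomp_lift, hu])
    change W (L.lift (u.restrict (fun _ β h => (hP' β).2 (Or.inl h)) le_rfl))
    rwa [this]

/-- The simplices of `P'` which do not belong to `P`. -/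
def missing (P P' : Sieve k) : Set (Σ m : Fin (k.len + 1), (⦋m⦌ ⟶ k)) :=
  {p | P' p.2 ∧ ¬ P p.2}

/-- If `f` has matching covers, then restriction of families to a smaller sieve is a cover. -/
theorem Lim.exists_extend [CartesianMonoidalCategory C] (hW : IsCoverClass W)
    (hf : HasMatching W f) (L : Lim f P Q) (hPP' : P ≤ P') (hQ : P' ≤ Q) :
    ∃ L' : Lim f P' Q, W (L.lift (L'.fam.restrict hPP' le_rfl)) := by
  have := hW.isMultiplicative
  induction hn : (missing P P').ncard using Nat.strong_induction_on generalizing P with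
  | _ n ih =>
  by_cases hex : ∃ (n : ℕ) (α : ⦋n⦌ ⟶ k), P' α ∧ ¬ P α
  · classical
    obtain ⟨α, hα', hα⟩ := Nat.find_spec hex
    have hmin : ∀ {m : SimplexCategory} (β : m ⟶ k), m.len < Nat.find hex → P' β → P β := by
      intro m β hm hβ
      by_contra h
      exact Nat.find_min hex hm ⟨β, hβ, h⟩
    generalize Nat.find hex = l at α hα' hα hmin
    -- Otherwise `α` would be a degeneracy of a simplex of `P'` of smaller dimension, which lies in
    -- `P` by minimality.
    have hmono : Mono α := by
      obtain ⟨p, e, s, i, hs, hi, rfl⟩ := exists_factorization α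
      have hp : ¬ p.len < l := fun hp => hα <| P.downward_closed (hmin i hp (by
        have := P'.downward_closed hα' s
        rwa [← Category.assoc, hs, Category.id_comp] at this)) e
      have he : Epi e := SimplexCategory.epi_iff_surjective.2
        ((surjective_iff_exists_section e).2 ⟨s, hs⟩)
      have : IsIso e := (SimplexCategory.isIso_iff_of_epi e).2
        (le_antisymm (not_lt.1 hp) (SimplexCategory.len_le_of_epi e))
      infer_instance
    let P'' : Sieve k :=
      { arrows := fun m β => P β ∨ ∃ ρ : m ⟶ ⦋l⦌, ρ ≫ α = β
        downward_closed := by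
          rintro m m' β (h | ⟨ρ, rfl⟩) θ
          · exact Or.inl (P.downward_closed h θ)
          · exact Or.inr ⟨θ ≫ ρ, by simp⟩ }
    have hbd : ∀ {m'} (ρ : m' ⟶ ⦋l⦌), bdSieve ⦋l⦌ ρ → P (ρ ≫ α) := by
      intro m' ρ hρ
      obtain ⟨p, σ, β, hp, rfl⟩ := bdSieve_le_skSieve _ _ hρ
      rw [Category.assoc]
      exact P.downward_closed (hmin (β ≫ α) hp (P'.downward_closed hα' β)) σ
    have hP1 : P ≤ P'' := fun _ β h => Or.inl h
    have hP2 : P'' ≤ P' := by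
      rintro _ β (h | ⟨ρ, rfl⟩)
      · exact hPP' _ h
      · exact P'.downward_closed hα' ρ
    obtain ⟨L₁, hL₁⟩ := L.exists_attach (P' := P'') hW hf α hα (hQ _ hα') hbd (fun β => Iff.rfl)
    have hlt : (missing P'' P').ncard < n := by
      rw [← hn]
      refine Set.ncard_lt_ncard ⟨fun p hp => ⟨hp.1, fun h => hp.2 (hP1 _ h)⟩, fun hs => ?_⟩
        (Set.toFinite _)
      -- Monomorphisms into `k` have dimension at most `k.len`, so `α` is among the finitely many
      -- simplices that are counted.
      have hl := SimplexCategory.len_le_of_mono α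
      have : (⟨⟨l, Nat.lt_succ_of_le hl⟩, α⟩ : Σ m : Fin (k.len + 1), (⦋m⦌ ⟶ k)) ∈ missing P P' :=
        ⟨hα', hα⟩
      exact (hs this).2 (Or.inr ⟨𝟙 _, by simp⟩)
    obtain ⟨L₂, hL₂⟩ := ih _ hlt L₁ hP2 rfl
    refine ⟨L₂, ?_⟩
    have : L.lift (L₂.fam.restrict hPP' le_rfl) =
        L₁.lift (L₂.fam.restrict hP2 le_rfl) ≫ L.lift (L₁.fam.restrict hP1 le_rfl) := by
      rw [Lim.comp_lift, ← Family.precomp_restrict, L₁.precomp_lift]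
      rfl
    rw [this]
    exact W.comp_mem _ _ hL₂ hL₁
  · have h : P' = P := le_antisymm (fun m β hβ => by
      by_contra h
      exact hex ⟨m.len, β, hβ, h⟩) hPP'
    subst h
    refine ⟨L, ?_⟩
    have : L.lift (L.fam.restrict hPP' le_rfl) = 𝟙 _ :=
      L.hom_ext (by rw [L.precomp_lift, Family.precomp_id]; rfl)
    rw [this]
    exact W.id_mem _

lemma IsCoverClass.of_isIso [CartesianMonoidalCategory C] (hW : IsCoverClass W) {A B : C}
    (g : A ⟶ B) [IsIso g] : W g := by
  have := hW.isStableUnderBaseChange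
  have := hW.isMultiplicative
  exact W.of_isIso g

/-- If `f` has matching covers, then the map from simplices to families is a cover. -/
theorem Lim.cover [CartesianMonoidalCategory C] (hW : IsCoverClass W)
    (hf : HasMatching W f) (L : Lim f P ⊤) : W (L.lift (Family.ofSimplex f _ _ (𝟙 _))) := by
  have := hW.isMultiplicative
  obtain ⟨L', hL'⟩ := L.exists_extend hW hf (P' := ⊤) le_top le_rfl
  -- The simplices of `X` are the families on the maximal sieve, so the comparison map is a
  -- restriction map up to an isomorphism.
  have : L.lift (Family.ofSimplex f _ _ (𝟙 _)) =
      ((Lim.ofTop f ⊤).iso L').hom ≫ L.lift (L'.fam.restrict le_top le_rfl) := by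
    rw [Lim.comp_lift]
    exact L.lift_congr (congrArg (fun d : Family f (⊤ : Sieve k) ⊤ (X.obj (op k)) =>
      d.restrict (le_top : P ≤ ⊤) (le_refl ⊤)) (L'.precomp_lift (Lim.ofTop f ⊤).fam)).symm
  have hi : W ((Lim.ofTop f ⊤).iso L').hom := hW.of_isIso _
  rw [this]
  exact W.comp_mem _ _ hi hL'

variable (f k) in
/-- The families indexed by the empty sieve in `X` and the maximal one in `Y`. -/
def Lim.ofBot : Lim f (⊥ : Sieve k) ⊤ where
  obj := Y.obj (op k)
  fam :=
    { app := fun _ h => h.elim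
      base := fun α _ => Y.map α.op
      app_map := fun _ _ h => h.elim
      base_map := fun _ _ _ => by simp
      app_comp := fun _ h => h.elim }
  existsUnique T d := by
    refine ⟨d.base (𝟙 k) trivial, ?_, fun g hg => ?_⟩
    · refine Family.ext (fun α h => h.elim) (fun α h => ?_)
      exact (d.base_map α _ _).trans (d.base_congr (by simp) _)
    · rw [← hg]
      simp

/-- The limit for the empty sieve is `Y_k`; the simplices of `P` are then attached to it. -/
lemma HasMatching.exists_lim [CartesianMonoidalCategory C] (hW : IsCoverClass W)
    (hf : HasMatching W f) (P : Sieve k) : Nonempty (Lim f P ⊤) :=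
  ⟨((Lim.ofBot f k).exists_extend hW hf (bot_le : (⊥ : Sieve k) ≤ P) le_top).choose⟩

/-- This is the comparison map for the empty sieve. -/
lemma HasMatching.cover_app [CartesianMonoidalCategory C] (hW : IsCoverClass W)
    (hf : HasMatching W f) (k : SimplexCategory) : W (f.app (op k)) := by
  have h := (Lim.ofBot f k).cover hW hf
  have : (Lim.ofBot f k).lift (Family.ofSimplex f _ _ (𝟙 _)) = f.app (op k) := by
    have := (Lim.ofBot f k).lift_base (Family.ofSimplex f _ _ (𝟙 _)) (𝟙 k) trivial
    simpa [Lim.ofBot] using this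
  rwa [← this]

lemma IsHypercover.hasMatching [CartesianMonoidalCategory C] {n : ℕ∞} (hf : IsHypercover W n f) :
    HasMatching W f := by
  intro m
  induction m using SimplexCategory.rec with | _ m =>
  obtain ⟨L, hL, -⟩ := hf.matching m
  refine ⟨Lim.ofRelLimit L, ?_⟩
  have := Lim.ofRelLimit_lift L
  rw [← this] at hL
  exact hL

lemma HasMatching.isHypercover [CartesianMonoidalCategory C] (hf : HasMatching W f)
    (hX : IsLieGroupoid W ⊤ X) (hY : IsLieGroupoid W ⊤ Y) : IsHypercover W ⊤ f where
  source := hX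
  target := hY
  matching k := by
    obtain ⟨L, hL⟩ := hf ⦋k⦌
    refine ⟨Lim.toRelLimit (S := SSet.boundary.{0} k) L, ?_, fun h => ?_⟩
    · have := Lim.toRelLimit_comparison (S := SSet.boundary.{0} k) L
      exact (congrArg (fun g => W g) this).mpr hL
    · simp at h

/-- The identity has matching covers. -/
lemma HasMatching.id [CartesianMonoidalCategory C] (hW : IsCoverClass W) (X : SimplicialObject C) :
    HasMatching W (𝟙 X) := by
  have := hW.isMultiplicative
  intro m
  let L : Lim (𝟙 X) (bdSieve m) ⊤ :=
    { obj := X.obj (op m)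
      fam := Family.ofSimplex _ _ _ (𝟙 _)
      existsUnique := fun T d => by
        have hd : ∀ {m'} (α : m' ⟶ m), d.base (𝟙 m) trivial ≫ X.map α.op = d.base α trivial :=
          fun α => (d.base_map α _ _).trans (d.base_congr (by simp) _)
        refine ⟨d.base (𝟙 m) trivial, ?_, fun g hg => ?_⟩
        · refine Family.ext (fun α h => ?_) (fun α h => ?_)
          · have := d.app_comp α h trivial
            simp only [NatTrans.id_app, Category.comp_id] at this
            simp [hd, this]
          · simp [hd]
        · rw [← hg]
          simp }
  refine ⟨L, ?_⟩
  have : L.lift (Family.ofSimplex _ _ _ (𝟙 _)) = 𝟙 _ :=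
    L.hom_ext (by rw [L.precomp_lift]; exact (Family.precomp_id _).symm)
  rw [this]
  exact W.id_mem _

end Attach

/-! ### Relatively coskeletal maps and their matching objects -/

section Coskeletal

variable {C : Type u} [Category.{v} C] {W : MorphismProperty C}
  {X Y Z : SimplicialObject C} {f : X ⟶ Y} {k : SimplexCategory} {P Q P' : Sieve k} {T : C} {n : ℕ}

/-- A compatible family on the simplices of dimension `< n` of an `(n - 1)`-dimensional sieve
extends to the whole sieve. -/
lemma exists_extension (hP : P ≤ skSieve n k)
    (a : ∀ {m : SimplexCategory} (α : m ⟶ k), P α → m.len < n → (T ⟶ X.obj (op m)))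
    (ha : ∀ {m m' : SimplexCategory} (θ : m' ⟶ m) (α : m ⟶ k) (h : P α) (hm : m.len < n)
      (hm' : m'.len < n), a α h hm ≫ X.map θ.op = a (θ ≫ α) (P.downward_closed h θ) hm') :
    ∃ b : ∀ {m : SimplexCategory} (α : m ⟶ k), P α → (T ⟶ X.obj (op m)),
      (∀ {m m' : SimplexCategory} (θ : m' ⟶ m) (α : m ⟶ k) (h : P α),
        b α h ≫ X.map θ.op = b (θ ≫ α) (P.downward_closed h θ)) ∧
      ∀ {m : SimplexCategory} (α : m ⟶ k) (h : P α) (hm : m.len < n), b α h = a α h hm := by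
  have acongr : ∀ {m : SimplexCategory} {α β : m ⟶ k} (e : α = β) (h : P α) (hm : m.len < n),
      a α h hm = a β (e ▸ h) hm := by
    rintro m α β rfl h hm; rfl
  choose p e s i hs hi hei using fun (m : SimplexCategory) (α : m ⟶ k) => exists_factorization α
  have hPi : ∀ {m : SimplexCategory} (α : m ⟶ k), P α → P (i m α) := by
    intro m α h
    have := P.downward_closed h (s m α)
    rwa [← hei m α, ← Category.assoc, hei m α, hs, Category.id_comp] at this
  have hpn : ∀ {m : SimplexCategory} (α : m ⟶ k), P α → (p m α).len < n := by
    intro m α h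
    obtain ⟨r, ξ, β, hr, hα⟩ := hP _ h
    have h1 : (s m α ≫ ξ) ≫ β = i m α := by
      rw [Category.assoc, hα, ← Category.id_comp (i m α), ← hs, Category.assoc, hei]
    have : Mono ((s m α ≫ ξ) ≫ β) := h1 ▸ hi m α
    have := mono_of_mono (s m α ≫ ξ) β
    exact (SimplexCategory.len_le_of_mono (s m α ≫ ξ)).trans_lt hr
  -- The value on `α` is defined through its image. `key1` and `key2` show that every factorization
  -- through a simplex of `P` of dimension `< n` gives the same value, and compatibility follows.
  let b : ∀ {m : SimplexCategory} (α : m ⟶ k), P α → (T ⟶ X.obj (op m)) := fun {m} α h =>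
    a (i m α) (hPi α h) (hpn α h) ≫ X.map (e m α).op
  have key1 : ∀ {m r : SimplexCategory} (ξ : m ⟶ r) (β : r ⟶ k) (α : m ⟶ k) (hα : P α) (hβ : P β)
      (hr : r.len < n) [Mono β], ξ ≫ β = α → b α hα = a β hβ hr ≫ X.map ξ.op := by
    intro m r ξ β α hα hβ hr _ hξ
    have h1 : (s m α ≫ ξ) ≫ β = i m α := by
      rw [Category.assoc, hξ, ← Category.id_comp (i m α), ← hs, Category.assoc, hei]
    have h2 : e m α ≫ s m α ≫ ξ = ξ := by
      rw [← cancel_mono β, Category.assoc, h1, hei, hξ]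
    change a (i m α) _ _ ≫ X.map (e m α).op = _
    rw [acongr h1.symm, ← ha (s m α ≫ ξ) β hβ hr, Category.assoc, ← X.map_comp, ← op_comp, h2]
  have key2 : ∀ {m r : SimplexCategory} (ξ : m ⟶ r) (β : r ⟶ k) (α : m ⟶ k) (hα : P α) (hβ : P β)
      (hr : r.len < n), ξ ≫ β = α → b α hα = a β hβ hr ≫ X.map ξ.op := by
    intro m r ξ β α hα hβ hr hξ
    have := hi r β
    rw [key1 (ξ ≫ e r β) (i r β) α hα (hPi β hβ) (hpn β hβ) (by rw [Category.assoc, hei, hξ]),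
      acongr (hei r β).symm, ← ha (e r β) (i r β) (hPi β hβ) (hpn β hβ), Category.assoc,
      ← X.map_comp, ← op_comp]
  refine ⟨b, ?_, ?_⟩
  · intro m m' θ α h
    beta_reduce
    rw [key2 (θ ≫ e m α) (i m α) (θ ≫ α) (P.downward_closed h θ) (hPi α h) (hpn α h)
      (by rw [Category.assoc, hei])]
    change (a (i m α) _ _ ≫ X.map (e m α).op) ≫ _ = _
    rw [Category.assoc, ← X.map_comp, ← op_comp]
  · intro m α h hm
    beta_reduce
    rw [key2 (𝟙 m) α α h h hm (by simp)]
    simp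

/-- Compatible families on an `(n - 1)`-dimensional sieve are determined by their values in
dimensions `< n`. -/
lemma family_determined (hP : P ≤ skSieve n k)
    (a b : ∀ {m : SimplexCategory} (α : m ⟶ k), P α → (T ⟶ X.obj (op m)))
    (ha : ∀ {m m' : SimplexCategory} (θ : m' ⟶ m) (α : m ⟶ k) (h : P α),
      a α h ≫ X.map θ.op = a (θ ≫ α) (P.downward_closed h θ))
    (hb : ∀ {m m' : SimplexCategory} (θ : m' ⟶ m) (α : m ⟶ k) (h : P α),
      b α h ≫ X.map θ.op = b (θ ≫ α) (P.downward_closed h θ))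
    (hab : ∀ {m : SimplexCategory} (α : m ⟶ k) (h : P α), m.len < n → a α h = b α h)
    {m : SimplexCategory} (α : m ⟶ k) (h : P α) : a α h = b α h := by
  obtain ⟨p, e, s, i, hs, hi, rfl⟩ := exists_factorization α
  have hpi : P i := by
    have := P.downward_closed h s
    rwa [← Category.assoc, hs, Category.id_comp] at this
  have hp : p.len < n := by
    obtain ⟨r, ξ, β, hr, rfl⟩ := hP _ hpi
    have := mono_of_mono ξ β
    exact (SimplexCategory.len_le_of_mono ξ).trans_lt hr
  rw [← ha e i hpi, hab i hpi hp, hb e i hpi]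

lemma Family.ext_sk (hP : P ≤ skSieve n k) {d d' : Family f P Q T}
    (h : ∀ {m : SimplexCategory} (α : m ⟶ k) (hα : P α), m.len < n → d.app α hα = d'.app α hα)
    (h' : ∀ {m : SimplexCategory} (α : m ⟶ k) (hα : Q α), d.base α hα = d'.base α hα) : d = d' :=
  Family.ext (family_determined hP d.app d'.app d.app_map d'.app_map h) h'

/-- If `q` is an isomorphism in dimensions `< n`, then it induces a bijection on families indexed by
`(n - 1)`-dimensional sieves. -/
lemma Family.exists_push_eq {q : X ⟶ Z} {t : Z ⟶ Y} (w : q ≫ t = f)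
    (hq : ∀ m : SimplexCategory, m.len < n → IsIso (q.app (op m))) (hP : P ≤ skSieve n k)
    (d : Family t P Q T) : ∃! d' : Family f P Q T, d'.push q t w = d := by
  obtain ⟨b, hb, hba⟩ := exists_extension (X := X) (T := T) hP
    (fun {m} α h hm => have := hq m hm; d.app α h ≫ inv (q.app (op m)))
    (fun {m m'} θ α h hm hm' => by
      have := hq m hm
      have := hq m' hm'
      rw [← cancel_mono (q.app (op m'))]
      simpa using d.app_map θ α h)
  have hbq : ∀ {m : SimplexCategory} (α : m ⟶ k) (h : P α), b α h ≫ q.app (op m) = d.app α h :=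
    family_determined hP (fun {m} α h => b α h ≫ q.app (op m)) d.app
      (fun θ α h => by rw [Category.assoc, ← q.naturality, ← Category.assoc, hb]) d.app_map
      (fun {m} α h hm => by
        have := hq m hm
        rw [hba α h hm]; simp)
  refine ⟨⟨b, d.base, hb, d.base_map, fun {m} α h h' => ?_⟩, ?_, ?_⟩
  · rw [← w, NatTrans.comp_app, ← Category.assoc, hbq, d.app_comp α h h']
  · exact Family.ext hbq (fun _ _ => rfl)
  · intro d' hd'
    refine Family.ext_sk hP (fun {m} α h hm => ?_)
      (fun α h => congrArg (fun d => d.base α h) hd')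
    have := hq m hm
    rw [← cancel_mono (q.app (op m))]
    exact (congrArg (fun d => d.app α h) hd').trans (hbq α h).symm

/-- The simplices of the source of `f` are the families indexed by the `(n - 1)`-skeleton. -/
def IsCoskeletal (n : ℕ) (f : X ⟶ Y) : Prop :=
  ∀ (k : SimplexCategory) (T : C) (d : Family f (skSieve n k) ⊤ T),
    ∃! x : T ⟶ X.obj (op k), Family.ofSimplex f _ ⊤ x = d

lemma IsCoskeletal.hom_ext (hf : IsCoskeletal n f) {x y : T ⟶ X.obj (op k)}
    (h : ∀ {m : SimplexCategory} (α : m ⟶ k), skSieve n k α → x ≫ X.map α.op = y ≫ X.map α.op)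
    (h' : x ≫ f.app _ = y ≫ f.app _) : x = y :=
  (hf k T (Family.ofSimplex f _ ⊤ x)).unique rfl
    (Family.ext (fun α hα => (h α hα).symm) (fun α _ => by simp [reassoc_of% h']))

/-- If `f` is relatively coskeletal, then the simplices of `X` are the families indexed by any sieve
containing the skeleton. -/
def IsCoskeletal.lim (hf : IsCoskeletal n f) (hP : skSieve n k ≤ P) : Lim f P ⊤ where
  obj := X.obj (op k)
  fam := Family.ofSimplex f P ⊤ (𝟙 _)
  existsUnique T d := by
    -- The filler of the skeleton of `d` has the right faces on all of `P`: such a face and the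
    -- value of `d` have the same skeleton and the same image in `Y`.
    obtain ⟨x, hx, -⟩ := hf k T (d.restrict hP le_rfl)
    have hxb : x ≫ f.app (op k) = d.base (𝟙 k) trivial := by
      simpa using congrArg (fun d => d.base (𝟙 k) trivial) hx
    refine ⟨x, ?_, fun y hy => ?_⟩
    · beta_reduce
      rw [Family.ofSimplex_precomp, Category.comp_id]
      refine Family.ext (fun {m} α hα => ?_) (fun {m} α hα => ?_)
      · rw [Family.ofSimplex_app]
        refine hf.hom_ext (fun β hβ => ?_) ?_
        · rw [d.app_map, Category.assoc, ← X.map_comp, ← op_comp]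
          exact congrArg (fun d => d.app (β ≫ α) (skSieve_comp n α β hβ)) hx
        · rw [d.app_comp α hα trivial, Category.assoc, f.naturality, ← Category.assoc, hxb,
            d.base_map]
          exact d.base_congr (by simp) _
      · rw [Family.ofSimplex_base, ← Category.assoc, hxb, d.base_map]
        exact d.base_congr (by simp) _
    · beta_reduce at hy
      rw [Family.ofSimplex_precomp, Category.comp_id] at hy
      refine hf.hom_ext (fun α hα => ?_) ?_
      · exact (congrArg (fun d => d.app α (hP _ hα)) hy).trans
          (congrArg (fun d => d.app α hα) hx).symm
      · rw [hxb]
        simpa using congrArg (fun d => d.base (𝟙 k) trivial) hy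

lemma IsCoskeletal.lim_lift (hf : IsCoskeletal n f) (hP : skSieve n k ≤ P) :
    (hf.lim hP).lift (Family.ofSimplex f P ⊤ (𝟙 _)) = 𝟙 (X.obj (op k)) :=
  (hf.lim hP).hom_ext ((Lim.precomp_lift _ _).trans (Family.precomp_id _).symm)

lemma IsCoskeletal.exists_relLimit (hf : IsCoskeletal n f)
    (S : (SSet.stdSimplex.{0}.obj k).Subcomplex) (hS : skSieve n k ≤ sieveOf S) :
    ∃ L : RelLimit f S, IsIso L.comparison := by
  refine ⟨(hf.lim hS).toRelLimit, ?_⟩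
  have h := (hf.lim hS).toRelLimit_comparison.trans (hf.lim_lift hS)
  have : IsIso (𝟙 (X.obj (op k))) := inferInstance
  rw [← h] at this
  exact this

variable {q : X ⟶ Z} {t : Z ⟶ Y}

/-- In degrees `m < n` the boundary only involves dimensions where `q` is invertible, so `M_m(t)` is
`M_m(f)`. In degrees `m ≥ n` the boundary contains the `(n - 1)`-skeleton, so it has a unique filler
over each simplex of `Y` and `μ_m(t)` is invertible. -/
lemma IsCoskeletal.hasMatching [CartesianMonoidalCategory C] (hW : IsCoverClass W)
    (ht : IsCoskeletal n t) (hf : HasMatching W f) (w : q ≫ t = f)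
    (hq : ∀ m : SimplexCategory, m.len < n → IsIso (q.app (op m))) : HasMatching W t := by
  have := hW.isMultiplicative
  intro m
  by_cases hm : m.len < n
  · obtain ⟨L, hL⟩ := hf m
    have hP : bdSieve m ≤ skSieve n m := (bdSieve_le_skSieve m).trans (skSieve_of_le hm.le m)
    let L' : Lim t (bdSieve m) ⊤ :=
      { obj := L.obj
        fam := L.fam.push q t w
        existsUnique := fun T d => by
          obtain ⟨d', hd', hu⟩ := Family.exists_push_eq w hq hP d
          refine ⟨L.lift d', ?_, fun g hg => L.hom_ext ?_⟩
          · beta_reduce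
            rw [Family.push_precomp, L.precomp_lift, hd']
          · rw [L.precomp_lift]
            exact hu _ ((Family.push_precomp _ _ _ _ _).symm.trans hg) }
    refine ⟨L', ?_⟩
    have := hq m hm
    have e : L'.lift (Family.ofSimplex t _ _ (𝟙 _)) =
        inv (q.app (op m)) ≫ L.lift (Family.ofSimplex f _ _ (𝟙 _)) := by
      apply L'.hom_ext
      rw [L'.precomp_lift]
      change _ = (L.fam.push q t w).precomp _
      rw [Family.push_precomp, ← Family.precomp_precomp, L.precomp_lift, Family.ofSimplex_precomp,
        Family.ofSimplex_push]
      simp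
    rw [e]
    exact W.comp_mem _ _ (hW.of_isIso _) hL
  · refine ⟨ht.lim (skSieve_le_bdSieve (not_lt.1 hm)), ?_⟩
    rw [ht.lim_lift]
    exact W.id_mem _

/-- Families over `Y` from families over `Z`. -/
def Family.changeBase (d : Family q P Q T) (t : Z ⟶ Y) (w : q ≫ t = f) : Family f P Q T where
  app α h := d.app α h
  base {m} α h := d.base α h ≫ t.app (op m)
  app_map θ α h := d.app_map θ α h
  base_map θ α h := by rw [Category.assoc, ← t.naturality, ← Category.assoc, d.base_map]
  app_comp α h h' := by rw [← w, NatTrans.comp_app, ← Category.assoc, d.app_comp α h h']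

/-- In degrees `m < n` the map `q_m` and its faces are invertible, so `M_m(q)` is `X_m`. In degrees
`m ≥ n` a boundary in `X` and a simplex of `Y` over it determine the simplex of the intermediate
object by coskeletality, so `M_m(q)` is `M_m(f)`. -/
lemma IsCoskeletal.hasMatching_left [CartesianMonoidalCategory C] (hW : IsCoverClass W)
    (ht : IsCoskeletal n t) (hf : HasMatching W f) (w : q ≫ t = f)
    (hq : ∀ m : SimplexCategory, m.len < n → IsIso (q.app (op m))) : HasMatching W q := by
  have := hW.isMultiplicative
  intro m
  by_cases hm : m.len < n
  · have hqm := hq m hm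
    have hP : bdSieve m ≤ skSieve n m := (bdSieve_le_skSieve m).trans (skSieve_of_le hm.le m)
    let L' : Lim q (bdSieve m) ⊤ :=
      { obj := X.obj (op m)
        fam := Family.ofSimplex q _ _ (𝟙 _)
        existsUnique := fun T d => by
          refine ⟨d.base (𝟙 m) trivial ≫ inv (q.app (op m)), ?_, fun g hg => ?_⟩
          · beta_reduce
            rw [Family.ofSimplex_precomp, Category.comp_id]
            refine Family.ext_sk hP (fun {m'} α hα hm' => ?_) (fun α hα => ?_)
            · have := hq m' hm'
              rw [← cancel_mono (q.app (op m')), Family.ofSimplex_app, d.app_comp α hα trivial]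
              simp only [Category.assoc, q.naturality, IsIso.inv_hom_id_assoc]
              rw [d.base_map]
              exact d.base_congr (by simp) _
            · simp only [Family.ofSimplex_base, Category.assoc, IsIso.inv_hom_id_assoc]
              rw [d.base_map]
              exact d.base_congr (by simp) _
          · rw [← hg]
            simp }
    refine ⟨L', ?_⟩
    have : L'.lift (Family.ofSimplex q _ _ (𝟙 _)) = 𝟙 _ :=
      L'.hom_ext (by rw [L'.precomp_lift]; exact (Family.precomp_id _).symm)
    rw [this]
    exact W.id_mem _
  · obtain ⟨L, hL⟩ := hf m
    have hP : skSieve n m ≤ bdSieve m := skSieve_le_bdSieve (not_lt.1 hm)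
    let x : L.obj ⟶ Z.obj (op m) := (ht.lim hP).lift (L.fam.push q t w)
    have hx : Family.ofSimplex t _ ⊤ x = L.fam.push q t w := by
      have h := (ht.lim hP).precomp_lift (L.fam.push q t w)
      change (Family.ofSimplex t _ ⊤ (𝟙 _)).precomp x = _ at h
      rwa [Family.ofSimplex_precomp, Category.comp_id] at h
    let L' : Lim q (bdSieve m) ⊤ :=
      { obj := L.obj
        fam :=
          { app := fun α h => L.fam.app α h
            base := fun α _ => x ≫ Z.map α.op
            app_map := fun θ α h => L.fam.app_map θ α h
            base_map := fun θ α _ => by simp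
            app_comp := fun α h _ => (congrArg (fun d => d.app α h) hx).symm }
        existsUnique := fun T d => by
          have hgx : L.lift (d.changeBase t w) ≫ x = d.base (𝟙 m) trivial := by
            refine (ht.lim hP).hom_ext ?_
            change (Family.ofSimplex t _ ⊤ (𝟙 _)).precomp _ = (Family.ofSimplex t _ ⊤ (𝟙 _)).precomp _
            rw [Family.ofSimplex_precomp, Family.ofSimplex_precomp, Category.comp_id,
              Category.comp_id, ← Family.ofSimplex_precomp, hx]
            refine Family.ext (fun α hα => ?_) (fun α hα => ?_)
            · rw [Family.precomp_app, Family.push_app, ← Category.assoc, L.lift_app,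
                Family.ofSimplex_app, d.base_map]
              exact (d.app_comp α hα trivial).trans (d.base_congr (by simp) _)
            · rw [Family.precomp_base, Family.push_base, L.lift_base, Family.ofSimplex_base,
                ← t.naturality, ← Category.assoc, d.base_map]
              exact congrArg (· ≫ t.app _) (d.base_congr (by simp) _)
          refine ⟨L.lift (d.changeBase t w), ?_, fun g hg => ?_⟩
          · refine Family.ext (fun α hα => ?_) (fun α hα => ?_)
            · exact L.lift_app _ α hα
            · change _ ≫ x ≫ _ = _
              rw [← Category.assoc, hgx, d.base_map]
              exact d.base_congr (by simp) _
          · refine L.hom_ext ?_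
            rw [L.precomp_lift, ← hg]
            refine Family.ext (fun α hα => rfl) (fun α hα => ?_)
            change _ = (g ≫ x ≫ _) ≫ _
            have := congrArg (fun d => d.base α hα) hx
            simp only [Family.ofSimplex_base, Family.push_base] at this
            rw [Family.precomp_base, ← this]
            simp }
    refine ⟨L', ?_⟩
    have : L'.lift (Family.ofSimplex q _ _ (𝟙 _)) = L.lift (Family.ofSimplex f _ _ (𝟙 _)) := by
      refine L.hom_ext ?_
      rw [L.precomp_lift]
      have h := L'.precomp_lift (Family.ofSimplex q _ _ (𝟙 _))
      have h1 := congrArg (fun d => Family.changeBase d t w) h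
      refine Eq.trans ?_ (h1.trans ?_)
      · refine Family.ext (fun α hα => rfl) (fun α hα => ?_)
        change _ = (L'.lift _ ≫ x ≫ _) ≫ _
        have := congrArg (fun d => d.base α hα) hx
        simp only [Family.ofSimplex_base, Family.push_base] at this
        rw [Family.precomp_base, ← this]
        simp
      · refine Family.ext (fun α hα => rfl) (fun α hα => ?_)
        simp [Family.changeBase, ← w]
    rw [this]
    exact hL

end Coskeletal

/-! ### Horn fillers in the source of a hypercover -/

section LieGroupoid

variable {C : Type u} [Category.{v} C] [CartesianMonoidalCategory C] {W : MorphismProperty C}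
  {X Y : SimplicialObject C} {f : X ⟶ Y}

/-- The source of a map with matching covers to a Lie `∞`-groupoid is a Lie `∞`-groupoid. -/
theorem HasMatching.isLieGroupoid (hW : IsCoverClass W) (hf : HasMatching W f)
    (hY : IsLieGroupoid W ⊤ Y) : IsLieGroupoid W ⊤ X := by
  have := hW.isMultiplicative
  have := hW.isStableUnderBaseChange
  intro k i hk
  obtain ⟨LY', hLY', -⟩ := hY k i hk
  let P : Sieve ⦋k⦌ := sieveOf (SSet.horn.{0} k i)
  let LY : Lim (toPoint Y) P ⊤ := Lim.ofRelLimit LY'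
  let ν : Y _⦋k⦌ ⟶ LY.obj := LY.lift (Family.ofSimplex _ _ _ (𝟙 _))
  have hν : W ν := by
    have h := Lim.ofRelLimit_lift LY'
    rw [← h] at hLY'
    exact hLY'
  -- The object of horns in `Y`, viewed as a limit with no simplices in `X`. Enlarging the empty
  -- sieve to the horn yields the horns in `X` (as `L₁`) with their map `r` to the horns in `Y`.
  let L₀ : Lim f (⊥ : Sieve ⦋k⦌) P :=
    { obj := LY.obj
      fam :=
        { app := fun _ h => h.elim
          base := fun α h => LY.fam.app α h
          app_map := fun _ _ h => h.elim
          base_map := fun θ α h => LY.fam.app_map θ α h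
          app_comp := fun _ h => h.elim }
      existsUnique := fun T d => by
        obtain ⟨g, hg, hu⟩ := LY.existsUnique T
          { app := fun α h => d.base α h
            base := fun _ _ => toUnit T
            app_map := fun θ α h => d.base_map θ α h
            base_map := fun _ _ _ => toUnit_unique _ _
            app_comp := fun _ _ _ => toUnit_unique _ _ }
        refine ⟨g, ?_, fun g' hg' => hu g' ?_⟩
        · exact Family.ext (fun _ h => h.elim) (fun α h => congrArg (fun d => d.app α h) hg)
        · exact Family.ext (fun α h => congrArg (fun d => d.base α h) hg')
            (fun _ _ => toUnit_unique _ _) }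
  obtain ⟨L₁, -⟩ := L₀.exists_extend hW hf (bot_le : (⊥ : Sieve ⦋k⦌) ≤ P) le_rfl
  let r : L₁.obj ⟶ LY.obj := L₀.lift (L₁.fam.restrict bot_le le_rfl)
  have hr : ∀ {m} (α : m ⟶ ⦋k⦌) (h : P α), r ≫ LY.fam.app α h = L₁.fam.base α h := fun α h =>
    L₀.lift_base (L₁.fam.restrict bot_le le_rfl) α h
  have hνa : ∀ {m} (α : m ⟶ ⦋k⦌) (h : P α), ν ≫ LY.fam.app α h = Y.map α.op := fun α h => by
    rw [LY.lift_app]; simp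
  have := hW.hasPullback ν r hν
  -- The relative horns: horns in `X` with a filler in `Y` of their image.
  let N : Lim f P ⊤ :=
    { obj := pullback ν r
      fam :=
        { app := fun α h => pullback.snd ν r ≫ L₁.fam.app α h
          base := fun α _ => pullback.fst ν r ≫ Y.map α.op
          app_map := fun θ α h => by rw [Category.assoc, L₁.fam.app_map]
          base_map := fun _ _ _ => by simp
          app_comp := fun α h _ => by
            rw [Category.assoc, L₁.fam.app_comp α h h, ← hr α h, ← pullback.condition_assoc,
              hνa] }
      existsUnique := fun T d => by
        have hc : d.base (𝟙 _) trivial ≫ ν = L₁.lift (d.restrict le_rfl le_top) ≫ r := by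
          refine LY.hom_ext' (fun α h => ?_) (fun _ _ => toUnit_unique _ _)
          rw [Category.assoc, Category.assoc, hνa, hr, L₁.lift_base, d.base_map]
          exact d.base_congr (by simp) _
        refine ⟨pullback.lift _ _ hc, ?_, fun g hg => ?_⟩
        · refine Family.ext (fun α h => ?_) (fun α h => ?_)
          · rw [Family.precomp_app, pullback.lift_snd_assoc, L₁.lift_app]
            rfl
          · rw [Family.precomp_base, pullback.lift_fst_assoc, d.base_map]
            exact d.base_congr (by simp) _
        · apply pullback.hom_ext
          · rw [pullback.lift_fst, ← hg]
            simp
          · rw [pullback.lift_snd]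
            refine L₁.hom_ext' (fun α h => ?_) (fun α h => ?_)
            · rw [L₁.lift_app, ← hg]
              simp
            · rw [L₁.lift_base, Category.assoc, ← hr α h, ← pullback.condition_assoc, hνa, ← hg]
              rfl }
  have hN := N.cover hW hf
  let LX : Lim (toPoint X) P ⊤ :=
    { obj := L₁.obj
      fam :=
        { app := fun α h => L₁.fam.app α h
          base := fun _ _ => toUnit _
          app_map := fun θ α h => L₁.fam.app_map θ α h
          base_map := fun _ _ _ => toUnit_unique _ _
          app_comp := fun _ _ _ => toUnit_unique _ _ }
      existsUnique := fun T d => by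
        obtain ⟨g, hg, hu⟩ := L₁.existsUnique T
          { app := fun α h => d.app α h
            base := fun α h => d.app α h ≫ f.app _
            app_map := fun θ α h => d.app_map θ α h
            base_map := fun θ α h => by
              rw [Category.assoc, ← f.naturality, ← Category.assoc, d.app_map]
            app_comp := fun _ _ _ => rfl }
        refine ⟨g, ?_, fun g' hg' => hu g' ?_⟩
        · exact Family.ext (fun α h => congrArg (fun d => d.app α h) hg)
            (fun _ _ => toUnit_unique _ _)
        · refine Family.ext (fun α h => congrArg (fun d => d.app α h) hg') (fun α h => ?_)
          have := congrArg (fun d => d.app α h) hg'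
          change g' ≫ L₁.fam.app α h = d.app α h at this
          rw [Family.precomp_base, ← L₁.fam.app_comp α h h, ← Category.assoc, this] }
  refine ⟨LX.toRelLimit, ?_, fun h => by simp at h⟩
  -- The horn map of `X` goes through the relative horns; the first factor is a cover because `f`
  -- has matching covers, the second is a base change of the horn map of `Y`.
  have e : LX.lift (Family.ofSimplex _ _ _ (𝟙 _)) =
      N.lift (Family.ofSimplex _ _ _ (𝟙 _)) ≫ pullback.snd ν r := by
    refine LX.hom_ext' (fun α h => ?_) (fun _ _ => toUnit_unique _ _)
    rw [LX.lift_app, Category.assoc]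
    exact (N.lift_app (Family.ofSimplex _ _ _ (𝟙 _)) α h).symm
  refine (congrArg (fun g => W g) (LX.toRelLimit_comparison.trans e)).mpr ?_
  exact W.comp_mem _ _ hN (MorphismProperty.pullback_snd _ _ hν)

end LieGroupoid

/-! ### Combinatorics of the collapse map -/

section Collapse

lemma shift_map_val_of_lt (n : ℕ) {a b : SimplexCategory} (θ : a ⟶ b) (j : Fin (n + a.len + 1))
    (h : j.val < n) : (((shift n).map θ).toOrderHom j).val = j.val := by
  change (shiftHom n θ.toOrderHom j).val = _
  simp [shiftHom_apply, h]

lemma shift_map_val_of_ge (n : ℕ) {a b : SimplexCategory} (θ : a ⟶ b) (j : Fin (n + a.len + 1))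
    (h : n ≤ j.val) : (((shift n).map θ).toOrderHom j).val =
      n + (θ.toOrderHom ⟨j.val - n, by have := j.2; omega⟩).val := by
  change (shiftHom n θ.toOrderHom j).val = _
  simp [shiftHom_apply, not_lt.2 h]

lemma collapse_val (n : ℕ) (l : SimplexCategory) (j : Fin (n + l.len + 1)) :
    ((collapse n l).toOrderHom j).val = min j.val n := by
  by_cases h : j.val < n
  · rw [min_eq_left h.le]
    exact shift_map_val_of_lt n _ j h
  · rw [min_eq_right (not_lt.1 h)]
    exact shift_map_val_of_ge n _ j (not_lt.1 h)

lemma shift_map_collapse (n : ℕ) {l l' : SimplexCategory} (θ : l' ⟶ l) :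
    (shift n).map θ ≫ collapse n l = collapse n l' :=
  ((shift n).map_comp _ _).symm

lemma collapse_zero (n : ℕ) : collapse n ⦋0⦌ = 𝟙 ⦋n⦌ := by
  have : SimplexCategory.const ⦋0⦌ ⦋0⦌ 0 = 𝟙 ⦋0⦌ := Subsingleton.elim _ _
  exact (congrArg (shift n).map this).trans ((shift n).map_id _)

/-- A map `⦋0⦌ ⟶ l` defines a section of the collapse map. -/
def shiftPoint (n : ℕ) {l : SimplexCategory} (θ : ⦋0⦌ ⟶ l) : ⦋n⦌ ⟶ (shift n).obj l :=
  (shift n).map θ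

lemma shiftPoint_collapse (n : ℕ) {l : SimplexCategory} (θ : ⦋0⦌ ⟶ l) :
    shiftPoint n θ ≫ collapse n l = 𝟙 ⦋n⦌ :=
  (shift_map_collapse n θ).trans (collapse_zero n)

lemma horn_le_bdSieve (n : ℕ) (i : Fin (n + 1)) : sieveOf (SSet.horn.{0} n i) ≤ bdSieve ⦋n⦌ := by
  intro m α h hs
  exact h (Set.eq_univ_iff_forall.2 fun x => Or.inl (hs x))

/-- The boundary of `Δ[n]` is the union of the horn `Λ[n, n]` and the face opposite to the last
vertex. -/
lemma horn_last_or (n : ℕ) {m : SimplexCategory} (α : m ⟶ ⦋n⦌) (h : bdSieve ⦋n⦌ α) :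
    sieveOf (SSet.horn.{0} n (Fin.last n)) α ∨ ∀ x, (α.toOrderHom x).val < n := by
  by_cases h' : ∀ x, (α.toOrderHom x).val < n
  · exact Or.inr h'
  · refine Or.inl fun hu => h fun y => ?_
    rcases Set.eq_univ_iff_forall.1 hu y with hy | hy
    · exact hy
    · push Not at h'
      obtain ⟨x, hx⟩ := h'
      refine ⟨x, ?_⟩
      rw [show y = Fin.last n from hy]
      exact Fin.ext (le_antisymm (Nat.lt_succ_iff.1 (α.toOrderHom x).2) hx)

lemma comp_shiftPoint_eq (n : ℕ) {l m : SimplexCategory} (θ θ' : ⦋0⦌ ⟶ l) (α : m ⟶ ⦋n⦌)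
    (h : ∀ x, (α.toOrderHom x).val < n) : α ≫ shiftPoint n θ = α ≫ shiftPoint n θ' := by
  refine SimplexCategory.Hom.ext _ _ (OrderHom.ext _ _ (funext fun x => Fin.ext ?_))
  exact (shift_map_val_of_lt n θ _ (h x)).trans (shift_map_val_of_lt n θ' _ (h x)).symm

lemma bdSieve_of_comp_collapse (n : ℕ) {l m : SimplexCategory} (α : m ⟶ (shift n).obj l)
    (h : bdSieve ⦋n⦌ (α ≫ collapse n l)) : bdSieve ((shift n).obj l) α := by
  rw [bdSieve_iff] at h ⊢
  rintro ⟨s, hs⟩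
  refine h ⟨shiftPoint n (SimplexCategory.const ⦋0⦌ l 0) ≫ s, ?_⟩
  rw [Category.assoc, ← Category.assoc s, hs, Category.id_comp, shiftPoint_collapse]

/-- If a simplex of `∂(Δ[n - 1] ⋆ Δ[1])` has `n` as a vertex, then its faces which do not have it
as a vertex are mapped to the boundary by the collapse map. -/
lemma comp_collapse_bdSieve (n : ℕ) {m m' : SimplexCategory} (θ : m' ⟶ m)
    (α : m ⟶ (shift n).obj ⦋1⦌) (h : bdSieve _ α) (hα : ∃ x, (α.toOrderHom x).val = n)
    (hθ : ¬ ∃ x, ((θ ≫ α).toOrderHom x).val = n) :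
    bdSieve ⦋n⦌ ((θ ≫ α) ≫ collapse n ⦋1⦌) := by
  intro hs
  apply h
  have key : ∀ j : Fin (n + 1), ∃ x, min ((θ ≫ α).toOrderHom x).val n = j.val := by
    intro j
    obtain ⟨x, hx⟩ := hs j
    refine ⟨x, ?_⟩
    rw [← hx]
    exact (collapse_val n ⦋1⦌ ((θ ≫ α).toOrderHom x)).symm
  intro (y : Fin (n + 1 + 1))
  rcases lt_trichotomy y.val n with hy | hy | hy
  · obtain ⟨x, hx⟩ := key ⟨y.val, by omega⟩
    refine ⟨θ.toOrderHom x, Fin.ext ?_⟩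
    change ((θ ≫ α).toOrderHom x).val = _
    dsimp only at hx
    omega
  · obtain ⟨x, hx⟩ := hα
    exact ⟨x, Fin.ext (hx.trans hy.symm)⟩
  · obtain ⟨x, hx⟩ := key (Fin.last n)
    refine ⟨θ.toOrderHom x, Fin.ext ?_⟩
    change ((θ ≫ α).toOrderHom x).val = _
    have h1 : ((θ ≫ α).toOrderHom x).val ≠ n := fun h => hθ ⟨x, h⟩
    have h2 : ((θ ≫ α).toOrderHom x).val < n + 1 + 1 := ((θ ≫ α).toOrderHom x).2
    have h3 := y.2
    rw [Fin.val_last] at hx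
    omega

end Collapse

/-! ### Higher morphism spaces and their orbit spaces -/

section MorphismSpaces

variable {C : Type u} [Category.{v} C] {W : MorphismProperty C}
  {X Y : SimplicialObject C} {f : X ⟶ Y} {T T' : C} {n : ℕ}

lemma RelFamily.app_congr {k : SimplexCategory} {S : (SSet.stdSimplex.{0}.obj k).Subcomplex}
    (z : RelFamily f S T) {m : SimplexCategory} {α β : m ⟶ k} (e : α = β)
    (h : SSet.stdSimplex.objEquiv.symm α ∈ S.obj (op m))
    (h' : SSet.stdSimplex.objEquiv.symm β ∈ S.obj (op m)) : z.app m α h = z.app m β h' := by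
  subst e; rfl

/-- `IsRelMorphism` for a map whose target is written in terms of `X`. -/
def IsRelMor (n : ℕ) (f : X ⟶ Y) (l : SimplexCategory) (x : T ⟶ X.obj (op ((shift n).obj l))) :
    Prop :=
  IsRelMorphism n f l x

lemma isRelMor_iff {l : SimplexCategory} {x : T ⟶ X.obj (op ((shift n).obj l))} :
    IsRelMor n f l x ↔ ∃ z : RelFamily f (SSet.horn.{0} n (Fin.last n)) T,
      (∀ (m : SimplexCategory) (α : m ⟶ (shift n).obj l)
        (h : SSet.stdSimplex.objEquiv.symm (α ≫ collapse n l) ∈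
          (SSet.horn.{0} n (Fin.last n)).obj (op m)),
        x ≫ X.map α.op = z.app m (α ≫ collapse n l) h) ∧
      x ≫ f.app (op ((shift n).obj l)) = z.base ≫ Y.map (collapse n l).op := Iff.rfl

lemma IsRelMor.precomp {l : SimplexCategory} {x : T ⟶ X.obj (op ((shift n).obj l))}
    (hx : IsRelMor n f l x) (g : T' ⟶ T) : IsRelMor n f l (g ≫ x) := by
  obtain ⟨z, h1, h2⟩ := isRelMor_iff.1 hx
  refine isRelMor_iff.2 ⟨z.precomp g, fun m α h => ?_, ?_⟩
  · rw [Category.assoc, h1 m α h]; rfl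
  · rw [Category.assoc, h2]; exact (Category.assoc _ _ _).symm

lemma IsRelMor.map {l l' : SimplexCategory} {x : T ⟶ X.obj (op ((shift n).obj l))}
    (hx : IsRelMor n f l x) (θ : l' ⟶ l) :
    IsRelMor n f l' (x ≫ X.map ((shift n).map θ).op) := by
  obtain ⟨z, h1, h2⟩ := isRelMor_iff.1 hx
  have e : ∀ {m : SimplexCategory} (α : m ⟶ (shift n).obj l'),
      (α ≫ (shift n).map θ) ≫ collapse n l = α ≫ collapse n l' := fun α => by
    rw [Category.assoc, shift_map_collapse]
  refine isRelMor_iff.2 ⟨z, fun m α h => ?_, ?_⟩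
  · rw [Category.assoc, ← X.map_comp, ← op_comp, h1 m (α ≫ (shift n).map θ) (by rwa [e])]
    exact z.app_congr (e α) _ _
  · rw [Category.assoc, f.naturality, ← Category.assoc, h2, Category.assoc, ← Y.map_comp, ← op_comp,
      shift_map_collapse]

/-- Restricting an `(n + l)`-simplex to the preimage of the horn under the collapse map is a cover,
so its pullback along the object of horns exists; that pullback represents the relative morphisms.
-/
lemma exists_represents_isRelMorphism [CartesianMonoidalCategory C] (hW : IsCoverClass W)
    (hf : HasMatching W f) (n : ℕ) (l : SimplexCategory) :
    ∃ (R : C) (i : R ⟶ X.obj (op ((shift n).obj l))), IsRelMor n f l i ∧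
      ∀ (T : C) (x : T ⟶ X.obj (op ((shift n).obj l))), IsRelMor n f l x →
        ∃! p : T ⟶ R, p ≫ i = x := by
  let Λ : Sieve ⦋n⦌ := sieveOf (SSet.horn.{0} n (Fin.last n))
  let S : Sieve ((shift n).obj l) := Λ.pullback (collapse n l)
  obtain ⟨LS⟩ := hf.exists_lim hW S
  obtain ⟨H⟩ := hf.exists_lim hW Λ
  have hκ := LS.cover hW hf
  let g : H.obj ⟶ LS.obj := LS.lift (H.fam.pull (collapse n l) (fun _ h => h) (fun _ _ => trivial))
  have := hW.hasPullback (LS.lift (Family.ofSimplex f _ _ (𝟙 _))) g hκ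
  let a := pullback.fst (LS.lift (Family.ofSimplex f _ _ (𝟙 _))) g
  let b := pullback.snd (LS.lift (Family.ofSimplex f _ _ (𝟙 _))) g
  have hab : Family.ofSimplex f S ⊤ a =
      (H.fam.pull (collapse n l) (fun _ h => h) (fun _ _ => trivial)).precomp b := by
    have h : a ≫ _ = b ≫ _ := pullback.condition
    rw [Lim.comp_lift, Lim.comp_lift, Family.ofSimplex_precomp, Category.comp_id] at h
    rw [← LS.precomp_lift (Family.ofSimplex f S ⊤ a), h, LS.precomp_lift]
  have h1 : ∀ {m : SimplexCategory} (α : m ⟶ (shift n).obj l) (h : Λ (α ≫ collapse n l)),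
      a ≫ X.map α.op = b ≫ H.fam.app (α ≫ collapse n l) h := fun α h =>
    congrArg (fun d => d.app α h) hab
  have h2 : ∀ {m : SimplexCategory} (α : m ⟶ (shift n).obj l),
      a ≫ f.app _ ≫ Y.map α.op = b ≫ H.fam.base (α ≫ collapse n l) trivial := fun α =>
    congrArg (fun d => d.base α trivial) hab
  -- This section of the collapse map recovers the horn from the simplex, so the second component of
  -- a map to the pullback is determined by the first.
  let s := shiftPoint n (SimplexCategory.const ⦋0⦌ l 0)
  have hs : ∀ {m : SimplexCategory} (α : m ⟶ ⦋n⦌), (α ≫ s) ≫ collapse n l = α := fun α => by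
    rw [Category.assoc, shiftPoint_collapse, Category.comp_id]
  refine ⟨pullback (LS.lift (Family.ofSimplex f _ _ (𝟙 _))) g, a, ?_, fun T x hx => ?_⟩
  · refine isRelMor_iff.2 ⟨(H.fam.precomp b).toRel, fun m α h => h1 α h, ?_⟩
    have := h2 (𝟙 _)
    simp only [op_id, Y.map_id, Category.comp_id] at this
    rw [this]
    change _ = (b ≫ H.fam.base (𝟙 _) trivial) ≫ _
    rw [Category.assoc, H.fam.base_map]
    exact congrArg (b ≫ ·) (H.fam.base_congr (by simp) _)
  · obtain ⟨z, hz1, hz2⟩ := isRelMor_iff.1 hx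
    have hc : x ≫ LS.lift (Family.ofSimplex f _ _ (𝟙 _)) = H.lift (Family.ofRel z) ≫ g := by
      rw [Lim.comp_lift, Lim.comp_lift]
      refine LS.lift_congr (Family.ext (fun {m} α h => ?_) (fun α h => ?_))
      · rw [Family.precomp_app, Family.ofSimplex_app, Category.id_comp]
        exact (hz1 m α h).trans (H.lift_app (Family.ofRel z) (α ≫ collapse n l) h).symm
      · rw [Family.precomp_base, Family.ofSimplex_base, Category.id_comp, ← Category.assoc, hz2]
        refine Eq.trans ?_ (H.lift_base (Family.ofRel z) (α ≫ collapse n l) trivial).symm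
        simp [Family.ofRel]
    refine ⟨pullback.lift x (H.lift (Family.ofRel z)) hc, pullback.lift_fst _ _ _, fun p hp => ?_⟩
    apply pullback.hom_ext
    · rw [pullback.lift_fst]; exact hp
    · rw [pullback.lift_snd]
      change p ≫ b = _
      refine H.hom_ext' (fun {m} α h => ?_) (fun α _ => ?_)
      · have hα : Λ ((α ≫ s) ≫ collapse n l) := by rwa [hs]
        have e := h1 (α ≫ s) hα
        rw [H.fam.app_congr (hs α)] at e
        rw [H.lift_app, Category.assoc, ← e, ← Category.assoc, hp, hz1 _ _ hα]
        exact z.app_congr (hs α) _ _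
      · have e := h2 (α ≫ s)
        rw [H.fam.base_congr (hs α)] at e
        rw [H.lift_base, Category.assoc, ← e, ← Category.assoc, hp, ← Category.assoc, hz2,
          Category.assoc, ← Y.map_comp, ← op_comp, hs]
        rfl

/-- Higher morphism spaces of maps with matching covers exist. -/
theorem HasMatching.exists_morphismSpace [CartesianMonoidalCategory C] (hW : IsCoverClass W)
    (hf : HasMatching W f) (n : ℕ) : Nonempty (MorphismSpace n f) := by
  choose R i hi hu using exists_represents_isRelMorphism hW hf n
  choose p hp hp' using hu
  have hom_ext : ∀ {l : SimplexCategory} {T : C} {a b : T ⟶ R l}, a ≫ i l = b ≫ i l → a = b := by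
    intro l T a b h
    rw [hp' l T (b ≫ i l) ((hi l).precomp b) a h]
    exact (hp' l T (b ≫ i l) ((hi l).precomp b) b rfl).symm
  have hi' : ∀ {l l' : SimplexCategoryᵒᵖ} (θ : l ⟶ l'),
      IsRelMor n f l'.unop (i l.unop ≫ X.map ((shift n).map θ.unop).op) := fun {l l'} θ =>
    (hi l.unop).map θ.unop
  have hp1 : ∀ {l l' : SimplexCategoryᵒᵖ} (θ : l ⟶ l'),
      p l'.unop _ _ (hi' θ) ≫ i l'.unop = i l.unop ≫ X.map ((shift n).map θ.unop).op :=
    fun θ => hp _ _ _ (hi' θ)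
  exact ⟨{
    obj :=
      { obj := fun l => R l.unop
        map := fun {l l'} θ => p l'.unop _ _ (hi' θ)
        map_id := fun l => hom_ext (by rw [hp1]; simp)
        map_comp := fun {l l' l''} θ ξ => hom_ext (by
          rw [hp1, Category.assoc, hp1, ← Category.assoc, hp1, unop_comp, Functor.map_comp, op_comp,
            X.map_comp, Category.assoc]) }
    incl :=
      { app := fun l => i l.unop
        naturality := fun {l l'} θ => hp1 θ }
    isRelMorphism := hi
    existsUnique := fun l T x hx => ⟨p l T x hx, hp l T x hx, hp' l T x hx⟩ }⟩

/-- For `l = 0` the collapse map is the identity, so every `n`-simplex satisfies the condition. -/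
lemma MorphismSpace.isIso_incl_zero (P : MorphismSpace n f) :
    IsIso (P.incl.app (op ⦋0⦌)) := by
  have h : ∀ {T : C} (x : T ⟶ (dec n X).obj (op ⦋0⦌)), IsRelMorphism n f ⦋0⦌ x := by
    intro T x
    refine ⟨RelFamily.ofSimplex f _ (T := T) x, fun m α _ => ?_, ?_⟩
    · change _ = x ≫ X.map (α ≫ collapse n ⦋0⦌).op
      rw [collapse_zero]
      exact congrArg (fun β => x ≫ X.map (Quiver.Hom.op β)) (Category.comp_id α).symm
    · rw [collapse_zero]
      change _ = (x ≫ f.app _) ≫ Y.map (𝟙 _)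
      rw [Y.map_id, Category.comp_id]
      rfl
  obtain ⟨p, hp, -⟩ := P.existsUnique ⦋0⦌ _ (𝟙 _) (h _)
  refine ⟨p, (P.existsUnique ⦋0⦌ _ _ (P.isRelMorphism ⦋0⦌)).unique ?_ ?_, hp⟩
  · rw [Category.assoc, hp, Category.comp_id]
  · rw [Category.id_comp]

/-- Homotopic simplices have the same image in the matching object: on the horn both are prescribed
by `z`, and on the face opposite to the last vertex the two inclusions of `⦋n⦌` agree. -/
lemma IsRelMor.ofSimplex_eq {l : SimplexCategory} {x : T ⟶ X.obj (op ((shift n).obj l))}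
    (hx : IsRelMor n f l x) (θ θ' : ⦋0⦌ ⟶ l) :
    Family.ofSimplex f (bdSieve ⦋n⦌) ⊤ (x ≫ X.map (shiftPoint n θ).op) =
      Family.ofSimplex f (bdSieve ⦋n⦌) ⊤ (x ≫ X.map (shiftPoint n θ').op) := by
  obtain ⟨z, h1, h2⟩ := isRelMor_iff.1 hx
  have e : ∀ (θ : ⦋0⦌ ⟶ l) {m : SimplexCategory} (α : m ⟶ ⦋n⦌),
      (α ≫ shiftPoint n θ) ≫ collapse n l = α := fun θ m α => by
    rw [Category.assoc, shiftPoint_collapse, Category.comp_id]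
  refine Family.ext (fun {m} α hα => ?_) (fun {m} α _ => ?_)
  · simp only [Family.ofSimplex_app, Category.assoc, ← X.map_comp, ← op_comp]
    rcases horn_last_or n α hα with h | h
    · rw [h1 m (α ≫ shiftPoint n θ) (by rw [e]; exact h),
        h1 m (α ≫ shiftPoint n θ') (by rw [e]; exact h)]
      exact z.app_congr ((e θ α).trans (e θ' α).symm) _ _
    · rw [comp_shiftPoint_eq n θ θ' α h]
  · have h3 : ∀ θ : ⦋0⦌ ⟶ l, (x ≫ X.map (shiftPoint n θ).op) ≫ f.app (op ⦋n⦌) = z.base := by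
      intro θ
      rw [Category.assoc, f.naturality, ← Category.assoc, h2, Category.assoc, ← Y.map_comp,
        ← op_comp, shiftPoint_collapse]
      simp
    rw [Family.ofSimplex_base, Family.ofSimplex_base, ← Category.assoc, h3, ← Category.assoc, h3]

/-- Two `n`-simplices with the same boundary and the same image in `Y` are locally homotopic. -/
lemma exists_homotopy [CartesianMonoidalCategory C] (hW : IsCoverClass W) (hf : HasMatching W f)
    (x y : T ⟶ X _⦋n⦌)
    (hxy : Family.ofSimplex f (bdSieve ⦋n⦌) ⊤ x = Family.ofSimplex f (bdSieve ⦋n⦌) ⊤ y) :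
    ∃ (T' : C) (c : T' ⟶ T) (h : T' ⟶ X.obj (op ((shift n).obj ⦋1⦌))), W c ∧
      IsRelMor n f ⦋1⦌ h ∧
      h ≫ X.map (shiftPoint n (SimplexCategory.δ (0 : Fin 2))).op = c ≫ x ∧
      h ≫ X.map (shiftPoint n (SimplexCategory.δ (1 : Fin 2))).op = c ≫ y := by
  classical
  have := hW.isStableUnderBaseChange
  have hxya : ∀ {m : SimplexCategory} (α : m ⟶ ⦋n⦌), bdSieve _ α →
      x ≫ X.map α.op = y ≫ X.map α.op := fun α hα => congrArg (fun d => d.app α hα) hxy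
  have hxyb : x ≫ f.app _ = y ≫ f.app _ := by
    simpa using congrArg (fun d => d.base (𝟙 _) trivial) hxy
  -- Simplices through the vertex `n` are sent to `y`, the others to `x`, in both cases along the
  -- collapse map. So the face opposite to `n` is `x` and the face opposite to `n + 1` is `y`; on
  -- overlaps the collapse lands in the boundary, where `x` and `y` agree.
  let a : ∀ {m : SimplexCategory} (α : m ⟶ (shift n).obj ⦋1⦌), (T ⟶ X.obj (op m)) := fun {m} α =>
    (if ∃ j, (α.toOrderHom j).val = n then y else x) ≫ X.map (α ≫ collapse n ⦋1⦌).op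
  let d : Family f (bdSieve ((shift n).obj ⦋1⦌)) ⊤ T :=
    { app := fun α _ => a α
      base := fun α _ => x ≫ f.app _ ≫ Y.map (α ≫ collapse n ⦋1⦌).op
      app_map := fun {m m'} θ α h => by
        change (_ ≫ _) ≫ _ = _ ≫ _
        rw [Category.assoc, ← X.map_comp, ← op_comp, ← Category.assoc]
        by_cases h1 : ∃ j, (α.toOrderHom j).val = n
        · rw [if_pos h1]
          by_cases h2 : ∃ j, ((θ ≫ α).toOrderHom j).val = n
          · rw [if_pos h2]
          · rw [if_neg h2, hxya _ (comp_collapse_bdSieve n θ α h h1 h2)]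
        · rw [if_neg h1, if_neg]
          rintro ⟨j, hj⟩
          exact h1 ⟨θ.toOrderHom j, hj⟩
      base_map := fun θ α _ => by simp
      app_comp := fun α h _ => by
        change (_ ≫ _) ≫ _ = _
        rw [Category.assoc, f.naturality]
        split_ifs
        · rw [← Category.assoc, ← hxyb, Category.assoc]
        · rfl }
  obtain ⟨M, hM⟩ := hf ((shift n).obj ⦋1⦌)
  -- Pulling back `μ_{n+1}(f)` along the glued boundary supplies both the cover `c` and a filler `h`
  -- over it.
  have := hW.hasPullback (M.lift (Family.ofSimplex f _ _ (𝟙 _))) (M.lift d) hM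
  let h := pullback.fst (M.lift (Family.ofSimplex f _ _ (𝟙 _))) (M.lift d)
  let c := pullback.snd (M.lift (Family.ofSimplex f _ _ (𝟙 _))) (M.lift d)
  have w : Family.ofSimplex f (bdSieve ((shift n).obj ⦋1⦌)) ⊤ h = d.precomp c := by
    have e : h ≫ _ = c ≫ _ := pullback.condition
    rw [Lim.comp_lift, Lim.comp_lift, Family.ofSimplex_precomp, Category.comp_id] at e
    rw [← M.precomp_lift (Family.ofSimplex f _ ⊤ h), e, M.precomp_lift]
  have w1 : ∀ {m : SimplexCategory} (α : m ⟶ (shift n).obj ⦋1⦌), bdSieve _ α →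
      h ≫ X.map α.op = c ≫ a α := fun α hα => congrArg (fun d => d.app α hα) w
  have hpt : ∀ θ : ⦋0⦌ ⟶ ⦋1⦌, bdSieve ((shift n).obj ⦋1⦌) (shiftPoint n θ) := by
    intro θ hs
    have := SimplexCategory.epi_iff_surjective.2 hs
    have := SimplexCategory.len_le_of_epi (shiftPoint n θ)
    change n + 1 ≤ n at this
    omega
  refine ⟨_, c, h, MorphismProperty.pullback_snd _ _ hM, ?_, ?_, ?_⟩
  · refine isRelMor_iff.2 ⟨RelFamily.ofSimplex f _ (c ≫ x), fun m α hα => ?_, ?_⟩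
    · have hb := horn_le_bdSieve n _ _ hα
      rw [w1 α (bdSieve_of_comp_collapse n α hb)]
      change c ≫ _ ≫ _ = (c ≫ x) ≫ _
      rw [Category.assoc]
      split_ifs
      · rw [hxya _ hb]
      · rfl
    · have := congrArg (fun d => d.base (𝟙 _) trivial) w
      simp only [Family.ofSimplex_base, op_id, Y.map_id, Category.comp_id] at this
      rw [this]
      change c ≫ x ≫ _ ≫ Y.map (𝟙 _ ≫ _).op = ((c ≫ x) ≫ _) ≫ _
      simp
  · rw [w1 _ (hpt _)]
    change c ≫ _ ≫ _ = _
    rw [shiftPoint_collapse, if_neg]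
    · simp
    · rintro ⟨j, hj⟩
      by_cases hjn : j.val < n
      · have := (shift_map_val_of_lt n (SimplexCategory.δ (0 : Fin 2)) j hjn).symm.trans hj
        omega
      · have h3 := (shift_map_val_of_ge n (SimplexCategory.δ (0 : Fin 2)) j
          (not_lt.1 hjn)).symm.trans hj
        exact Fin.succAbove_ne (0 : Fin 2) (⟨j.val - n, by have : j.val < n + 1 := j.2; omega⟩ : Fin 1)
          (Fin.ext (Nat.add_eq_left.1 h3))
  · rw [w1 _ (hpt _)]
    change c ≫ _ ≫ _ = _
    rw [shiftPoint_collapse, if_pos]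
    · simp
    · refine ⟨Fin.last n, ?_⟩
      refine (shift_map_val_of_ge n (SimplexCategory.δ (1 : Fin 2)) (Fin.last n) le_rfl).trans ?_
      rw [Nat.add_eq_left]
      have : (⟨(Fin.last n).val - n, by simp⟩ : Fin 1) = 0 := Subsingleton.elim _ _
      exact congrArg (fun x : Fin 1 => ((SimplexCategory.δ (1 : Fin 2)).toOrderHom x).val) this

/-- A cover is a coequalizer; this permits equalities to be checked after passing to a cover. -/
lemma IsCoverClass.epi [CartesianMonoidalCategory C] (hW : IsCoverClass W) {A B : C} {g : A ⟶ B}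
    (hg : W g) : Epi g := by
  have := hW.hasPullback g g hg
  obtain ⟨h⟩ := hW.effectiveEpi g _ _ (IsPullback.of_hasPullback g g) hg
  exact epi_of_isColimit_cofork h

/-- The orbit space of the higher morphism space is the matching object. -/
theorem MorphismSpace.isOrbitSpace [CartesianMonoidalCategory C] (hW : IsCoverClass W)
    (hf : HasMatching W f) (P : MorphismSpace n f) (L : Lim f (bdSieve ⦋n⦌) ⊤) :
    IsOrbitSpace W P.obj ((P.incl.app (op ⦋0⦌) : P.obj _⦋0⦌ ⟶ X _⦋n⦌) ≫
      L.lift (Family.ofSimplex f _ _ (𝟙 _))) := by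
  have := hW.isMultiplicative
  have := P.isIso_incl_zero
  let i : P.obj _⦋0⦌ ⟶ X _⦋n⦌ := P.incl.app (op ⦋0⦌)
  let r := L.lift (Family.ofSimplex f _ _ (𝟙 (X _⦋n⦌)))
  have hi : IsIso i := P.isIso_incl_zero
  have hp : W (i ≫ r) := W.comp_mem _ _ (hW.of_isIso i) (L.cover hW hf)
  let j : P.obj _⦋1⦌ ⟶ X.obj (op ((shift n).obj ⦋1⦌)) := P.incl.app (op ⦋1⦌)
  have hδ : ∀ k : Fin 2, P.obj.δ k ≫ i = j ≫ X.map (shiftPoint n (SimplexCategory.δ k)).op :=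
    fun k => P.incl.naturality (SimplexCategory.δ k).op
  have hr : ∀ {T : C} (x : T ⟶ X _⦋n⦌), x ≫ r = L.lift (Family.ofSimplex f _ _ x) := fun x => by
    rw [Lim.comp_lift, Family.ofSimplex_precomp, Category.comp_id]
  have w : P.obj.δ (0 : Fin 2) ≫ i ≫ r = P.obj.δ (1 : Fin 2) ≫ i ≫ r := by
    rw [← Category.assoc, hδ, ← Category.assoc, hδ, hr, hr]
    exact L.lift_congr (IsRelMor.ofSimplex_eq (P.isRelMorphism ⦋1⦌) _ _)
  -- Maps with the same image in the matching object are homotopic after a cover. So whatever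
  -- coequalizes the two face maps also coequalizes the kernel pair of the cover `i ≫ r`, and
  -- therefore descends.
  have key : ∀ {T S : C} (x y : T ⟶ P.obj _⦋0⦌) (s : P.obj _⦋0⦌ ⟶ S), x ≫ i ≫ r = y ≫ i ≫ r →
      P.obj.δ (0 : Fin 2) ≫ s = P.obj.δ (1 : Fin 2) ≫ s → x ≫ s = y ≫ s := by
    intro T S x y s hxy hs
    obtain ⟨T', c, h, hcov, hh, h0, h1⟩ := exists_homotopy hW hf (x ≫ i) (y ≫ i) (by
      rw [← Category.assoc, ← Category.assoc, hr, hr] at hxy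
      rw [← L.precomp_lift (Family.ofSimplex f _ _ (x ≫ i)), hxy, L.precomp_lift])
    have := hW.epi hcov
    obtain ⟨p, hp, -⟩ := P.existsUnique ⦋1⦌ _ h hh
    have hp : p ≫ j = h := hp
    have e0 : p ≫ P.obj.δ (0 : Fin 2) = c ≫ x := by
      rw [← cancel_mono i, Category.assoc, hδ, ← Category.assoc, hp, Category.assoc, h0]
    have e1 : p ≫ P.obj.δ (1 : Fin 2) = c ≫ y := by
      rw [← cancel_mono i, Category.assoc, hδ, ← Category.assoc, hp, Category.assoc, h1]
    rw [← cancel_epi c, ← Category.assoc, ← e0, ← Category.assoc, ← e1, Category.assoc,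
      Category.assoc, hs]
  have := hW.hasPullback _ (i ≫ r) hp
  obtain ⟨hc⟩ := hW.effectiveEpi _ _ _ (IsPullback.of_hasPullback (i ≫ r) (i ≫ r)) hp
  have := hW.epi hp
  refine ⟨hp, w, ⟨Cofork.IsColimit.mk' _ fun s => ?_⟩⟩
  have hs := key _ _ s.π (pullback.condition (f := i ≫ r) (g := i ≫ r)) s.condition
  refine ⟨hc.desc (Cofork.ofπ s.π hs), hc.fac (Cofork.ofπ s.π hs) WalkingParallelPair.one,
    fun {m} hm => ?_⟩
  rw [← cancel_epi (i ≫ r)]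
  exact hm.trans (hc.fac (Cofork.ofπ s.π hs) WalkingParallelPair.one).symm

end MorphismSpaces

/-! ### Existence: the relative coskeleton is a strictification -/

section Existence

variable {C : Type u} [Category.{v} C] {W : MorphismProperty C}
  {X Y : SimplicialObject C} {f : X ⟶ Y} {n : ℕ}

lemma Lim.isIso_lift {k : SimplexCategory} {P : Sieve k} (h : P = ⊤) (L : Lim f P ⊤) :
    IsIso (L.lift (Family.ofSimplex f P ⊤ (𝟙 _))) := by
  subst h
  exact inferInstanceAs (IsIso ((Lim.ofTop f ⊤).iso L).hom)

/-- The sieve is a variable, so that the identification of the `(n - 1)`-skeleton of `Δ[n]` with its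
boundary can be substituted. -/
lemma MorphismSpace.isOrbitSpace_of_eq [CartesianMonoidalCategory C] (hW : IsCoverClass W)
    (hf : HasMatching W f) (P : MorphismSpace n f) {B : Sieve ⦋n⦌} (hB : B = bdSieve ⦋n⦌)
    (L : Lim f B ⊤) :
    IsOrbitSpace W P.obj ((P.incl.app (op ⦋0⦌) : P.obj _⦋0⦌ ⟶ X _⦋n⦌) ≫
      L.lift (Family.ofSimplex f _ _ (𝟙 _))) := by
  subst hB
  exact P.isOrbitSpace hW hf L

section

variable (L : ∀ k : SimplexCategory, Lim f (skSieve n k) ⊤)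

/-- The pullback maps between objects of families. -/
noncomputable def coskMap {k k' : SimplexCategory} (θ : k' ⟶ k) : (L k).obj ⟶ (L k').obj :=
  (L k').lift ((L k).fam.pull θ (skSieve_comp n θ) (fun _ _ => trivial))

lemma coskMap_app {k k' : SimplexCategory} (θ : k' ⟶ k) {m : SimplexCategory} (α : m ⟶ k')
    (h : skSieve n k' α) :
    coskMap L θ ≫ (L k').fam.app α h = (L k).fam.app (α ≫ θ) (skSieve_comp n θ α h) :=
  (L k').lift_app _ α h

lemma coskMap_base {k k' : SimplexCategory} (θ : k' ⟶ k) {m : SimplexCategory} (α : m ⟶ k') :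
    coskMap L θ ≫ (L k').fam.base α trivial = (L k).fam.base (α ≫ θ) trivial :=
  (L k').lift_base _ α trivial

/-- The relative coskeleton. -/
noncomputable def relCosk : SimplicialObject C where
  obj k := (L k.unop).obj
  map θ := coskMap L θ.unop
  map_id k := (L k.unop).hom_ext'
    (fun α h => by
      rw [coskMap_app, Category.id_comp]
      exact (L k.unop).fam.app_congr (by simp) _)
    (fun α _ => by
      rw [coskMap_base, Category.id_comp]
      exact (L k.unop).fam.base_congr (by simp) _)
  map_comp {k k' k''} θ ξ := (L k''.unop).hom_ext'
    (fun α h => by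
      rw [coskMap_app, Category.assoc, coskMap_app, coskMap_app]
      exact (L k.unop).fam.app_congr (by simp) _)
    (fun α _ => by
      rw [coskMap_base, Category.assoc, coskMap_base, coskMap_base]
      exact (L k.unop).fam.base_congr (by simp) _)

lemma map_comp_lift_ofSimplex {k k' : SimplexCategory} (θ : k' ⟶ k) :
    X.map θ.op ≫ (L k').lift (Family.ofSimplex f _ _ (𝟙 _)) =
      (L k).lift (Family.ofSimplex f _ _ (𝟙 _)) ≫ coskMap L θ :=
  (L k').hom_ext'
    (fun α h => by
      rw [Category.assoc, Category.assoc, coskMap_app, Lim.lift_app, Lim.lift_app]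
      simp)
    (fun α _ => by
      rw [Category.assoc, Category.assoc, coskMap_base, Lim.lift_base, Lim.lift_base]
      simp)

/-- The map to the relative coskeleton. -/
noncomputable def toRelCosk : X ⟶ relCosk L where
  app k := (L k.unop).lift (Family.ofSimplex f _ _ (𝟙 _))
  naturality {k k'} θ := map_comp_lift_ofSimplex L θ.unop

/-- The map from the relative coskeleton. -/
noncomputable def ofRelCosk : relCosk L ⟶ Y where
  app k := (L k.unop).fam.base (𝟙 k.unop) trivial
  naturality {k k'} θ := by
    change coskMap L θ.unop ≫ _ = _
    rw [coskMap_base]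
    refine Eq.trans ?_ ((L k.unop).fam.base_map θ.unop (𝟙 k.unop) trivial).symm
    exact (L k.unop).fam.base_congr (by simp) _

lemma toRelCosk_ofRelCosk : toRelCosk L ≫ ofRelCosk L = f := by
  ext k
  change (L k.unop).lift _ ≫ (L k.unop).fam.base (𝟙 _) trivial = _
  rw [Lim.lift_base]
  simp

/-- A point of the coskeleton is a family in `X`; this identifies its own skeleton with the image of
that family, and thereby reduces coskeletality to the universal property of `L k`. -/
lemma ofSimplex_ofRelCosk {k : SimplexCategory} {T : C} (x : T ⟶ (L k).obj) :
    Family.ofSimplex (ofRelCosk L) (skSieve n k) ⊤ x =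
      ((L k).fam.precomp x).push (toRelCosk L) (ofRelCosk L) (toRelCosk_ofRelCosk L) := by
  refine Family.ext (fun {m} α h => ?_) (fun {m} α _ => ?_)
  · refine (L m).hom_ext' (fun β hβ => ?_) (fun β hβ => ?_)
    · change (x ≫ coskMap L α) ≫ _ = ((x ≫ (L k).fam.app α h) ≫ (L m).lift _) ≫ _
      rw [Category.assoc, coskMap_app, Category.assoc, Lim.lift_app, Category.assoc,
        Family.ofSimplex_app, Category.id_comp, (L k).fam.app_map]
    · change (x ≫ coskMap L α) ≫ _ = ((x ≫ (L k).fam.app α h) ≫ (L m).lift _) ≫ _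
      rw [Category.assoc, coskMap_base, Category.assoc, Lim.lift_base, Category.assoc,
        Family.ofSimplex_base, Category.id_comp, ← Category.assoc ((L k).fam.app α h),
        (L k).fam.app_comp α h trivial, (L k).fam.base_map]
  · change x ≫ (L k).fam.base (𝟙 k) trivial ≫ Y.map α.op = x ≫ (L k).fam.base α trivial
    rw [(L k).fam.base_map]
    exact congrArg (x ≫ ·) ((L k).fam.base_congr (by simp) _)

lemma isIso_toRelCosk (m : SimplexCategory) (hm : m.len < n) :
    IsIso ((toRelCosk L).app (op m)) :=
  (L m).isIso_lift (skSieve_eq_top hm)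

/-- The map from `X` is invertible in dimensions `< n`, so a family on the `(n - 1)`-skeleton lifts
uniquely to `X`, where it is classified by `L k`. -/
lemma isCoskeletal_ofRelCosk : IsCoskeletal n (ofRelCosk L) := by
  intro k T d
  obtain ⟨d', hd', hu⟩ := Family.exists_push_eq (toRelCosk_ofRelCosk L) (isIso_toRelCosk L) le_rfl d
  refine ⟨(L k).lift d', ?_, fun y hy => (L k).hom_ext ?_⟩
  · exact (ofSimplex_ofRelCosk L ((L k).lift d')).trans (by rw [Lim.precomp_lift, hd'])
  · rw [Lim.precomp_lift]
    exact hu _ ((ofSimplex_ofRelCosk L y).symm.trans hy)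

end

/-- Strictifications of maps with matching covers exist. -/
theorem HasMatching.exists_isStrictification [CartesianMonoidalCategory C] (hW : IsCoverClass W)
    (hf : HasMatching W f) (n : ℕ) :
    ∃ (τ : SimplicialObject C) (q : X ⟶ τ) (t : τ ⟶ Y), IsStrictification W n f q t := by
  let L : ∀ k : SimplexCategory, Lim f (skSieve n k) ⊤ := fun k =>
    (hf.exists_lim hW (skSieve n k)).some
  have ht := isCoskeletal_ofRelCosk L
  refine ⟨relCosk L, toRelCosk L, ofRelCosk L, toRelCosk_ofRelCosk L,
    fun k hk => isIso_toRelCosk L ⦋k⦌ hk, ?_, ?_, fun k => ?_⟩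
  · obtain ⟨P⟩ := hf.exists_morphismSpace hW n
    exact ⟨P, P.isOrbitSpace_of_eq hW hf (skSieve_len ⦋n⦌) (L ⦋n⦌)⟩
  · exact ht.exists_relLimit _ (skSieve_le_horn n (n + 1) 1 (Nat.lt_succ_self n))
  · exact ht.exists_relLimit _ (by
      rw [sieveOf_skeleton]
      exact skSieve_of_le (by omega) _)

end Existence

/-! ### Every strictification is relatively coskeletal -/

section Strictification

variable {C : Type u} [Category.{v} C] {W : MorphismProperty C}
  {X Y Z : SimplicialObject C} {f : X ⟶ Y} {q : X ⟶ Z} {t : Z ⟶ Y} {n : ℕ}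

/-- The simplices of `Z` over `k` are the families indexed by the `(n - 1)`-skeleton. -/
def IsCoskeletalAt (n : ℕ) (t : Z ⟶ Y) (k : SimplexCategory) : Prop :=
  ∀ (T : C) (d : Family t (skSieve n k) ⊤ T),
    ∃! x : T ⟶ Z.obj (op k), Family.ofSimplex t _ ⊤ x = d

lemma isCoskeletalAt_of_lt {k : SimplexCategory} (h : k.len < n) : IsCoskeletalAt n t k := by
  intro T d
  have e : skSieve n k = ⊤ := skSieve_eq_top h
  have h1 : ∀ (P : Sieve k), P = ⊤ → ∀ d : Family t P ⊤ T,
      ∃! x : T ⟶ Z.obj (op k), Family.ofSimplex t _ ⊤ x = d := by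
    rintro P rfl d
    simpa [Lim.ofTop, Family.ofSimplex_precomp] using (Lim.ofTop t ⊤).existsUnique T d
  exact h1 _ e d

lemma Lim.existsUnique_ofSimplex {k : SimplexCategory} {P : Sieve k} (L : Lim t P ⊤)
    (hL : IsIso (L.lift (Family.ofSimplex t _ _ (𝟙 _)))) {T : C} (d : Family t P ⊤ T) :
    ∃! x : T ⟶ Z.obj (op k), Family.ofSimplex t P ⊤ x = d := by
  have h : ∀ x : T ⟶ Z.obj (op k), x ≫ L.lift (Family.ofSimplex t _ _ (𝟙 _)) =
      L.lift (Family.ofSimplex t _ _ x) := fun x => by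
    rw [Lim.comp_lift, Family.ofSimplex_precomp, Category.comp_id]
  refine ⟨L.lift d ≫ inv (L.lift (Family.ofSimplex t _ _ (𝟙 _))), ?_, fun y hy => ?_⟩
  · beta_reduce
    rw [← L.precomp_lift (Family.ofSimplex t _ _ _), ← h, Category.assoc, IsIso.inv_hom_id,
      Category.comp_id, L.precomp_lift]
  · rw [IsIso.eq_comp_inv, h]
    exact L.lift_congr hy

/-- If the simplices over `k` are the families indexed by a sieve `S` of dimension `< N` containing
the `(n - 1)`-skeleton, and `t` is coskeletal in dimensions `< N`, then it is coskeletal at `k`. -/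
lemma isCoskeletalAt_of_relLimit {k : SimplexCategory} {N : ℕ} (hN : n ≤ N)
    {S : (SSet.stdSimplex.{0}.obj k).Subcomplex} (L : RelLimit t S) (hL : IsIso L.comparison)
    (hS : skSieve n k ≤ sieveOf S) (hS' : sieveOf S ≤ skSieve N k)
    (ht : ∀ m : SimplexCategory, m.len < N → IsCoskeletalAt n t m) : IsCoskeletalAt n t k := by
  have hL' : IsIso ((Lim.ofRelLimit L).lift (Family.ofSimplex t _ _ (𝟙 _))) :=
    (congrArg (fun g => IsIso g) (Lim.ofRelLimit_lift L)).mpr hL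
  intro T d
  -- The faces of dimension `< N` of the simplex sought are forced: each is the unique filler of a
  -- restriction of `d`. By uniqueness they are compatible, and so they extend to a family on `S`.
  have ex : ∀ {m : SimplexCategory} (α : m ⟶ k), m.len < N → ∃! x : T ⟶ Z.obj (op m),
      Family.ofSimplex t _ ⊤ x = d.pull α (skSieve_comp n α) (fun _ _ => trivial) :=
    fun {m} α hm => ht m hm T _
  choose a ha ha' using fun (m : SimplexCategory) (α : m ⟶ k) (hm : m.len < N) => ex α hm
  have amap : ∀ {m m' : SimplexCategory} (θ : m' ⟶ m) (α : m ⟶ k), ∀ (hm : m.len < N)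
      (hm' : m'.len < N), a m α hm ≫ Z.map θ.op = a m' (θ ≫ α) hm' := by
    intro m m' θ α hm hm'
    refine ha' m' (θ ≫ α) hm' _ ?_
    beta_reduce
    rw [← Family.ofSimplex_pull (P := skSieve n m) (Q := ⊤) _ θ (skSieve_comp n θ)
      (fun _ _ => trivial), ha m α hm]
    exact Family.ext (fun β h => d.app_congr (by simp) _) (fun β h => d.base_congr (by simp) _)
  have abase : ∀ {m : SimplexCategory} (α : m ⟶ k) (hm : m.len < N),
      a m α hm ≫ t.app (op m) = d.base α trivial := by
    intro m α hm
    have := congrArg (fun d => d.base (𝟙 m) trivial) (ha m α hm)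
    simp only [Family.ofSimplex_base, op_id, Y.map_id, Category.comp_id] at this
    rw [this]
    exact d.base_congr (by simp) _
  have aapp : ∀ {m : SimplexCategory} (α : m ⟶ k) (hm : m.len < n) (h : skSieve n k α),
      a m α (hm.trans_le hN) = d.app α h := by
    intro m α hm h
    have := congrArg (fun d => d.app (𝟙 m) (skSieve_of_len_lt _ hm)) (ha m α (hm.trans_le hN))
    simp only [Family.ofSimplex_app, op_id, Z.map_id, Category.comp_id] at this
    rw [this]
    exact d.app_congr (by simp) _
  obtain ⟨b, hb, hba⟩ := exists_extension (X := Z) (T := T) hS' (fun {m} α _ hm => a m α hm)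
    (fun θ α _ hm hm' => amap θ α hm hm')
  obtain ⟨x, hx, hxu⟩ := (Lim.ofRelLimit L).existsUnique_ofSimplex hL'
    { app := b
      base := d.base
      app_map := hb
      base_map := d.base_map
      app_comp := fun {m} α h _ => family_determined (X := Y) hS' (fun {m} α h => b α h ≫ t.app _)
        (fun α _ => d.base α trivial)
        (fun θ α h => by rw [Category.assoc, ← t.naturality, ← Category.assoc, hb])
        (fun θ α h => d.base_map θ α trivial)
        (fun α h hm => by rw [hba α h hm, abase α hm]) α h }
  have hxb : ∀ {m : SimplexCategory} (α : m ⟶ k) (h : sieveOf S α), x ≫ Z.map α.op = b α h :=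
    fun α h => congrArg (fun d => d.app α h) hx
  refine ⟨x, Family.ext_sk le_rfl (fun {m} α h hm => ?_)
    (fun α h => congrArg (fun d => d.base α h) hx), fun y hy => hxu _ ?_⟩
  · rw [Family.ofSimplex_app, hxb α (hS _ h), hba α _ (hm.trans_le hN), aapp α hm h]
  · refine Family.ext_sk hS' (fun {m} α h hm => ?_) (fun α h => ?_)
    · refine Eq.trans ?_ (hba α h hm).symm
      rw [Family.ofSimplex_app]
      refine ha' m α hm _ ?_
      beta_reduce at hy ⊢
      rw [← hy]
      exact (Family.ofSimplex_pull _ _ _ _).symm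
    · exact congrArg (fun d => d.base α h) hy

lemma IsStrictification.isIso_app (h : IsStrictification W n f q t) (m : SimplexCategory)
    (hm : m.len < n) : IsIso (q.app (op m)) :=
  h.isIso_of_lt m.len hm

/-- The object of `n`-simplices and the matching object are coequalizers of the same pair of face
maps, hence agree compatibly with the maps from `X_n`. A family in the strictification on the `(n -
1)`-skeleton lifts uniquely to `X`, so it is a point of the matching object. -/
lemma IsStrictification.isCoskeletalAt_self [CartesianMonoidalCategory C] (hW : IsCoverClass W)
    (hf : HasMatching W f) (h : IsStrictification W n f q t) : IsCoskeletalAt n t ⦋n⦌ := by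
  obtain ⟨P, hP, w, ⟨hc⟩⟩ := h.orbit
  obtain ⟨L⟩ := hf.exists_lim hW (skSieve n ⦋n⦌)
  obtain ⟨-, w', ⟨hc'⟩⟩ := P.isOrbitSpace_of_eq hW hf (skSieve_len ⦋n⦌) L
  let r := L.lift (Family.ofSimplex f (skSieve n ⦋n⦌) ⊤ (𝟙 (X _⦋n⦌)))
  have hr : Epi r := hW.epi (L.cover hW hf)
  let i : P.obj _⦋0⦌ ⟶ X _⦋n⦌ := P.incl.app (op ⦋0⦌)
  have hi : IsIso i := P.isIso_incl_zero
  have hepi : Epi (i ≫ q.app (op ⦋n⦌)) := hW.epi hP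
  have hqn : Epi (q.app (op ⦋n⦌)) := epi_of_epi i _
  obtain ⟨e, he⟩ : ∃ e : L.obj ⟶ Z _⦋n⦌, r ≫ e = q.app (op ⦋n⦌) := by
    refine ⟨hc'.desc (Cofork.ofπ _ w), ?_⟩
    rw [← cancel_epi i, ← Category.assoc]
    exact hc'.fac (Cofork.ofπ _ w) WalkingParallelPair.one
  obtain ⟨e', he'⟩ : ∃ e' : Z _⦋n⦌ ⟶ L.obj, q.app (op ⦋n⦌) ≫ e' = r := by
    refine ⟨hc.desc (Cofork.ofπ _ w'), ?_⟩
    rw [← cancel_epi i, ← Category.assoc]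
    exact hc.fac (Cofork.ofπ _ w') WalkingParallelPair.one
  have hee : e' ≫ e = 𝟙 _ := by
    rw [← cancel_epi (q.app (op ⦋n⦌)), ← Category.assoc, he', he, Category.comp_id]
  -- It suffices to compare the two after the epimorphism `r`, where both become the family of faces
  -- of `q_n`.
  have hu : L.fam.push q t h.fac = Family.ofSimplex t _ ⊤ e := by
    refine Family.ext_of_epi r ?_
    rw [Family.push_precomp, L.precomp_lift, Family.ofSimplex_push, Family.ofSimplex_precomp, he,
      Category.id_comp]
  intro T d
  obtain ⟨d', hd', hu'⟩ := Family.exists_push_eq h.fac h.isIso_app le_rfl d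
  refine ⟨L.lift d' ≫ e, ?_, fun y hy => ?_⟩
  · beta_reduce
    rw [← Family.ofSimplex_precomp, ← hu, Family.push_precomp, L.precomp_lift, hd']
  · have h1 : L.fam.precomp (y ≫ e') = d' := by
      refine hu' _ ?_
      beta_reduce
      rw [← Family.push_precomp, hu, Family.ofSimplex_precomp, Category.assoc, hee,
        Category.comp_id]
      exact hy
    rw [← h1, ← L.precomp_lift (L.fam.precomp (y ≫ e'))]
    have h2 : L.lift (L.fam.precomp (y ≫ e')) = y ≫ e' := L.hom_ext (L.precomp_lift _)
    rw [L.precomp_lift, h2, Category.assoc, hee, Category.comp_id]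

/-- The description climbs in three stages: degree `n` by the orbit space; degree `n + 1` because
the horn has dimension at most `n` and contains the `(n - 1)`-skeleton; all degrees because
simplices are determined by their `(n + 1)`-skeleta over `Y`. -/
theorem IsStrictification.isCoskeletal [CartesianMonoidalCategory C] (hW : IsCoverClass W)
    (hf : HasMatching W f) (h : IsStrictification W n f q t) : IsCoskeletal n t := by
  have h1 : ∀ m : SimplexCategory, m.len < n + 1 → IsCoskeletalAt n t m := by
    intro m hm
    rcases (Nat.lt_succ_iff.1 hm).lt_or_eq with hm' | hm'
    · exact isCoskeletalAt_of_lt hm'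
    · obtain rfl : m = ⦋n⦌ := by rw [← hm']
      exact h.isCoskeletalAt_self hW hf
  have h2 : ∀ m : SimplexCategory, m.len < n + 2 → IsCoskeletalAt n t m := by
    intro m hm
    rcases (Nat.lt_succ_iff.1 hm).lt_or_eq with hm' | hm'
    · exact h1 m hm'
    · obtain rfl : m = ⦋n + 1⦌ := by rw [← hm']
      obtain ⟨L, hL⟩ := h.horn
      exact isCoskeletalAt_of_relLimit (Nat.le_succ n) L hL
        (skSieve_le_horn n (n + 1) 1 (Nat.lt_succ_self n))
        ((horn_le_bdSieve _ _).trans (bdSieve_le_skSieve _)) h1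
  intro k
  obtain ⟨L, hL⟩ := h.coskeletal k.len
  exact isCoskeletalAt_of_relLimit (Nat.le_add_right n 2) L hL
    (by rw [sieveOf_skeleton]; exact skSieve_of_le (Nat.le_add_right n 2) _)
    (by rw [sieveOf_skeleton]) h2

end Strictification

/-! ### Coordinates and faces in `K(A, n)` -/

section Surjections

variable {k n : ℕ}

/-- Every surjection that shares the smallest section of `σ` lies above `σ`
(`Surj.le_of_min_section`). This makes the passage from coordinates to `n`-dimensional faces
triangular. -/
lemma Surj.exists_min_section (σ : Surj k n) : ∃ a : Fin (n + 1) →o Fin (k + 1),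
    σ.1.comp a = OrderHom.id ∧ ∀ i, a (σ.1 i) ≤ i := by
  have h : ∀ j, ∃ i, σ.1 i = j ∧ ∀ i', j ≤ σ.1 i' → i ≤ i' := by
    intro j
    obtain ⟨i₀, h₀⟩ := σ.2 j
    obtain ⟨i, hi, hmin⟩ := (Finset.univ.filter fun i => j ≤ σ.1 i).exists_min_image id
      ⟨i₀, by simp [h₀]⟩
    simp only [Finset.mem_filter, Finset.mem_univ, true_and, id] at hi hmin
    exact ⟨i, le_antisymm (h₀ ▸ σ.1.monotone (hmin i₀ h₀.ge)) hi, hmin⟩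
  choose a ha ha' using h
  exact ⟨⟨a, fun j j' hj => ha' j _ (hj.trans (ha j').ge)⟩, OrderHom.ext _ _ (funext ha),
    fun i => ha' _ i le_rfl⟩

/-- Dually, every surjection that shares the greatest section of `σ` lies below `σ`
(`Surj.le_of_max_section`). -/
lemma Surj.exists_max_section (σ : Surj k n) : ∃ a : Fin (n + 1) →o Fin (k + 1),
    σ.1.comp a = OrderHom.id ∧ ∀ i, i ≤ a (σ.1 i) := by
  have h : ∀ j, ∃ i, σ.1 i = j ∧ ∀ i', σ.1 i' ≤ j → i' ≤ i := by
    intro j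
    obtain ⟨i₀, h₀⟩ := σ.2 j
    obtain ⟨i, hi, hmax⟩ := (Finset.univ.filter fun i => σ.1 i ≤ j).exists_max_image id
      ⟨i₀, by simp [h₀]⟩
    simp only [Finset.mem_filter, Finset.mem_univ, true_and, id] at hi hmax
    exact ⟨i, le_antisymm hi (h₀ ▸ σ.1.monotone (hmax i₀ h₀.le)), hmax⟩
  choose a ha ha' using h
  exact ⟨⟨a, fun j j' hj => ha' j' _ ((ha j).le.trans hj)⟩, OrderHom.ext _ _ (funext ha),
    fun i => ha' _ i le_rfl⟩

lemma Surj.le_of_min_section {σ σ' : Surj k n} {a : Fin (n + 1) →o Fin (k + 1)}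
    (ha : ∀ i, a (σ.1 i) ≤ i) (h : σ'.1.comp a = OrderHom.id) : σ ≤ σ' := by
  intro i
  have h1 : σ'.1 (a (σ.1 i)) = σ.1 i := DFunLike.congr_fun h _
  exact h1.ge.trans (σ'.1.monotone (ha i))

lemma Surj.le_of_max_section {σ σ' : Surj k n} {a : Fin (n + 1) →o Fin (k + 1)}
    (ha : ∀ i, i ≤ a (σ.1 i)) (h : σ'.1.comp a = OrderHom.id) : σ' ≤ σ := by
  intro i
  have h1 : σ'.1 (a (σ.1 i)) = σ.1 i := DFunLike.congr_fun h _
  exact (σ'.1.monotone (ha i)).trans h1.le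

lemma injective_of_comp_eq_id {σ : Fin (k + 1) →o Fin (n + 1)} {a : Fin (n + 1) →o Fin (k + 1)}
    (h : σ.comp a = OrderHom.id) : Function.Injective a := by
  intro i j hij
  have hi : σ (a i) = i := DFunLike.congr_fun h i
  have hj : σ (a j) = j := DFunLike.congr_fun h j
  rw [← hi, hij, hj]

lemma Surj.apply_le (σ : Surj k n) (i : Fin (k + 1)) : (σ.1 i).val ≤ i.val := by
  obtain ⟨a, ha, hmin⟩ := σ.exists_min_section
  have hs : StrictMono a := a.monotone.strictMono_of_injective (injective_of_comp_eq_id ha)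
  have key : ∀ (m : ℕ) (h : m < n + 1), m ≤ (a ⟨m, h⟩).val := by
    intro m
    induction m with
    | zero => intro h; exact Nat.zero_le _
    | succ m ih =>
      intro h
      exact (ih (by omega)).trans_lt (hs (show (⟨m, by omega⟩ : Fin (n + 1)) < ⟨m + 1, h⟩ from
        Nat.lt_succ_self m))
  exact (key _ (σ.1 i).2).trans (hmin i)

lemma isEmpty_surj (h : k < n) : IsEmpty (Surj k n) :=
  ⟨fun σ => by
    have := Fintype.card_le_of_surjective σ.1 σ.2
    simp at this
    omega⟩

/-- The identity as a surjection. -/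
def idSurj (n : ℕ) : Surj n n := ⟨OrderHom.id, Function.surjective_id⟩

lemma eq_idSurj (σ : Surj n n) : σ = idSurj n := by
  have := SimplexCategory.epi_iff_surjective (f := SimplexCategory.mkHom σ.1) |>.2 σ.2
  exact Subtype.ext (congrArg SimplexCategory.Hom.toOrderHom
    (SimplexCategory.eq_id_of_epi (SimplexCategory.mkHom σ.1)))

variable {B : Type*} [CommMonoid B]

lemma emAct_eq_single (x : Surj k n → B) (a : Fin (n + 1) →o Fin (k + 1)) (σ : Surj k n)
    (hσ : σ.1.comp a = OrderHom.id)
    (h : ∀ σ', σ' ≠ σ → σ'.1.comp a = OrderHom.id → x σ' = 1) :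
    emAct n a x (idSurj n) = x σ := by
  classical
  refine (Finset.prod_eq_single σ (fun σ' _ hne => ?_) (by simp)).trans (if_pos hσ)
  split_ifs with h'
  · exact h σ' hne h'
  · rfl

/-- An element of `K(B, n)_k` is determined by its `n`-dimensional faces. -/
lemma eq_of_emAct_eq [IsLeftCancelMul B] (x y : Surj k n → B)
    (h : ∀ a : Fin (n + 1) →o Fin (k + 1), emAct n a x (idSurj n) = emAct n a y (idSurj n)) :
    x = y := by
  classical
  funext σ
  induction σ using WellFoundedGT.induction with
  | ind σ ih =>
  -- Downward induction: the face along the smallest section of `σ` is a product of `x σ` with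
  -- coordinates at surjections strictly above `σ`, which are already known to agree and can be
  -- cancelled.
  obtain ⟨a, ha, hmin⟩ := σ.exists_min_section
  have key : ∀ z : Surj k n → B, emAct n a z (idSurj n) =
      (∏ σ' ∈ Finset.univ.erase σ, if σ'.1.comp a = OrderHom.id then z σ' else 1) * z σ := by
    intro z
    refine (Finset.prod_erase_mul _ _ (Finset.mem_univ σ)).symm.trans ?_
    congr 1
    exact if_pos ha
  have h1 := h a
  rw [key, key] at h1
  have h2 : (∏ σ' ∈ Finset.univ.erase σ, if σ'.1.comp a = OrderHom.id then x σ' else 1) =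
      ∏ σ' ∈ Finset.univ.erase σ, if σ'.1.comp a = OrderHom.id then y σ' else 1 := by
    refine Finset.prod_congr rfl fun σ' hσ' => ?_
    split_ifs with h'
    · exact ih σ' (lt_of_le_of_ne (Surj.le_of_min_section hmin h') (Finset.ne_of_mem_erase hσ').symm)
    · rfl
  rw [h2] at h1
  exact mul_left_cancel h1

/-- The cocycle relation: if all the injective `n`-dimensional faces of `x` which are not sections
of the greatest surjection `c` are trivial, then those which are sections of `c` are equal. -/
lemma emAct_eq_of_trivial (x : Surj k n → B) (c : Surj k n) (hc : ∀ σ : Surj k n, σ ≤ c)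
    (h : ∀ a : Fin (n + 1) →o Fin (k + 1), Function.Injective a → c.1.comp a ≠ OrderHom.id →
      emAct n a x (idSurj n) = 1)
    (a : Fin (n + 1) →o Fin (k + 1)) (ha : c.1.comp a = OrderHom.id) :
    emAct n a x (idSurj n) = x c := by
  have key : ∀ σ : Surj k n, σ ≠ c → x σ = 1 := by
    intro σ
    induction σ using WellFoundedLT.induction with
    | ind σ ih =>
    intro hσ
    -- Upward induction: only surjections below `σ` contribute to the face along `b`, and by
    -- induction the face is `x σ`. It is trivial because `b` is not a section of `c`, for otherwise
    -- `c ≤ σ`.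
    obtain ⟨b, hb, hmax⟩ := σ.exists_max_section
    have hcb : c.1.comp b ≠ OrderHom.id := fun h' =>
      hσ (le_antisymm (hc σ) (Surj.le_of_max_section hmax h'))
    rw [← emAct_eq_single x b σ hb, h b (injective_of_comp_eq_id hb) hcb]
    intro σ' hne h'
    exact ih σ' (lt_of_le_of_ne (Surj.le_of_max_section hmax h') hne) (by rintro rfl; exact hcb h')
  exact emAct_eq_single x a c ha fun σ hσ _ => key σ hσ

end Surjections

/-! ### Descent of maps to `K(A, n)` along a strictification -/

section Factorization

variable {C : Type u} [Category.{v} C] [CartesianMonoidalCategory C] [BraidedCategory C]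
  {W : MorphismProperty C} {A : C} [GrpObj A] [IsCommMonObj A] {n : ℕ}
  {X Y : SimplicialObject C} {f : X ⟶ Y} {T T' : C}

/-- The coordinates of a simplex of `K(A, n)`. -/
noncomputable def emCoord {k : SimplexCategory} (w : T ⟶ (EilenbergMacLane A n).obj (op k)) :
    Surj k.len n → (T ⟶ A) :=
  fun σ => w ≫ Pi.π (fun _ : Surj k.len n => A) σ

lemma em_hom_ext {k : SimplexCategory} {w w' : T ⟶ (EilenbergMacLane A n).obj (op k)}
    (h : emCoord w = emCoord w') : w = w' :=
  Pi.hom_ext _ _ fun σ => congrFun h σ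

lemma emCoord_map {k m : SimplexCategory} (w : T ⟶ (EilenbergMacLane A n).obj (op k))
    (a : m ⟶ k) :
    emCoord (w ≫ (EilenbergMacLane A n).map a.op) = emAct n a.toOrderHom (emCoord w) := by
  funext τ
  refine (Category.assoc _ _ _).trans ((congrArg (w ≫ ·) (Pi.lift_π _ _)).trans ?_)
  exact comp_emAct w n a.toOrderHom _ τ

lemma emCoord_face (φ : X ⟶ EilenbergMacLane A n) {k m : SimplexCategory} (x : T ⟶ X.obj (op k))
    (a : m ⟶ k) :
    emCoord ((x ≫ X.map a.op) ≫ φ.app (op m)) = emAct n a.toOrderHom (emCoord (x ≫ φ.app _)) := by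
  rw [Category.assoc, φ.naturality, ← Category.assoc, emCoord_map]

/-- Maps to `K(A, n)` identify homotopic `n`-simplices. -/
lemma IsRelMor.comp_em_eq (φ : X ⟶ EilenbergMacLane A n)
    {h : T ⟶ X.obj (op ((shift n).obj ⦋1⦌))} (hh : IsRelMor n f ⦋1⦌ h) (θ θ' : ⦋0⦌ ⟶ ⦋1⦌) :
    (h ≫ X.map (shiftPoint n θ).op) ≫ φ.app (op ⦋n⦌) =
      (h ≫ X.map (shiftPoint n θ').op) ≫ φ.app (op ⦋n⦌) := by
  obtain ⟨z, h1, -⟩ := isRelMor_iff.1 hh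
  let c : Surj (n + 1) n := ⟨(collapse n ⦋1⦌).toOrderHom,
    (surjective_iff_exists_section _).2 ⟨shiftPoint n θ, shiftPoint_collapse n θ⟩⟩
  -- The collapse map is `i ↦ min i n`, which bounds every monotone surjection onto `⦋n⦌`.
  have hc : ∀ σ : Surj (n + 1) n, σ ≤ c := by
    intro σ (i : Fin (n + 1 + 1))
    rw [Fin.le_def]
    refine le_trans ?_ (collapse_val n ⦋1⦌ i).ge
    exact le_min (σ.apply_le i) (Nat.lt_succ_iff.1 (σ.1 i).2)
  have key : ∀ a : Fin (n + 1) →o Fin (n + 1 + 1), Function.Injective a →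
      c.1.comp a ≠ OrderHom.id →
      emAct n a (emCoord (k := (shift n).obj ⦋1⦌) (h ≫ φ.app _)) (idSurj n) = 1 := by
    intro a ha hca
    let α : ⦋n⦌ ⟶ (shift n).obj ⦋1⦌ := SimplexCategory.mkHom a
    have hbd : bdSieve ⦋n⦌ (α ≫ collapse n ⦋1⦌) := by
      intro hs
      have := SimplexCategory.epi_iff_surjective.2 hs
      exact hca (congrArg SimplexCategory.Hom.toOrderHom
        (SimplexCategory.eq_id_of_epi (α ≫ collapse n ⦋1⦌)))
    -- The alternative is that all `n + 1` values of the injective map `a` are `< n`, which is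
    -- impossible.
    have hhorn : sieveOf (SSet.horn.{0} n (Fin.last n)) (α ≫ collapse n ⦋1⦌) := by
      refine (horn_last_or n _ hbd).resolve_right fun hlt => ?_
      have h3 : ∀ x : Fin (n + 1), (a x).val < n := by
        intro x
        have h4 : min (a x).val n < n := (collapse_val n ⦋1⦌ (a x)).symm.trans_lt (hlt x)
        omega
      have := Fintype.card_le_of_injective (fun x : Fin (n + 1) => (⟨(a x).val, h3 x⟩ : Fin n))
        (fun x y hxy => ha (Fin.ext (Fin.mk.inj_iff.1 hxy)))
      simp at this
    -- The first factorization bounds the dimension; the second, through the image, stays inside the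
    -- horn. Together they present this face of `h` as a pullback of a simplex of `X` of dimension
    -- `< n`, where `K(A, n)` has no coordinates.
    obtain ⟨p, e, i, hp, hei⟩ := bdSieve_le_skSieve _ _ hbd
    obtain ⟨p', e', s, i', hs, hi', hei'⟩ := exists_factorization (α ≫ collapse n ⦋1⦌)
    have hp' : p'.len < n := by
      have h5 : i' = (s ≫ e) ≫ i := by
        rw [Category.assoc, hei, ← hei', ← Category.assoc, hs, Category.id_comp]
      have : Mono ((s ≫ e) ≫ i) := h5 ▸ hi'
      have := mono_of_mono (s ≫ e) i
      exact (SimplexCategory.len_le_of_mono (s ≫ e)).trans_lt hp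
    have hi'' : sieveOf (SSet.horn.{0} n (Fin.last n)) i' := by
      have := (sieveOf (SSet.horn.{0} n (Fin.last n))).downward_closed hhorn s
      rwa [← hei', ← Category.assoc, hs, Category.id_comp] at this
    have e1 : h ≫ X.map α.op = z.app p' i' hi'' ≫ X.map e'.op := by
      rw [h1 _ α hhorn, z.app_map p' ⦋n⦌ e' i' hi'' (by rw [hei']; exact hhorn)]
      exact z.app_congr hei'.symm _ _
    have e2 := emCoord_face φ h α
    rw [e1, emCoord_face] at e2
    refine (congrFun e2 (idSurj n)).symm.trans ?_
    have := isEmpty_surj hp'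
    exact Finset.prod_eq_one fun σ _ => isEmptyElim σ
  refine em_hom_ext (funext fun σ => ?_)
  have : σ = idSurj n := eq_idSurj σ
  subst this
  rw [emCoord_face, emCoord_face]
  exact (emAct_eq_of_trivial _ c hc key _ (congrArg SimplexCategory.Hom.toOrderHom
      (shiftPoint_collapse n θ))).trans
    (emAct_eq_of_trivial _ c hc key _ (congrArg SimplexCategory.Hom.toOrderHom
      (shiftPoint_collapse n θ'))).symm

variable {Z : SimplicialObject C} {q : X ⟶ Z} {t : Z ⟶ Y}

/-- In degree `n`, `φ` factors through the coequalizer `q_n` because it identifies homotopic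
simplices. In other degrees it is enough to compare `n`-dimensional faces, since these determine a
simplex of `K(A, n)`. -/
lemma IsStrictification.comp_em_eq (h : IsStrictification W n f q t)
    (φ : X ⟶ EilenbergMacLane A n) {k : SimplexCategory} (x y : T ⟶ X.obj (op k))
    (hxy : x ≫ q.app _ = y ≫ q.app _) : x ≫ φ.app _ = y ≫ φ.app _ := by
  obtain ⟨P, hP, w, ⟨hc⟩⟩ := h.orbit
  let i : P.obj _⦋0⦌ ⟶ X _⦋n⦌ := P.incl.app (op ⦋0⦌)
  have hi : IsIso i := P.isIso_incl_zero
  let j : P.obj _⦋1⦌ ⟶ X.obj (op ((shift n).obj ⦋1⦌)) := P.incl.app (op ⦋1⦌)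
  have hδ : ∀ k : Fin 2, P.obj.δ k ≫ i = j ≫ X.map (shiftPoint n (SimplexCategory.δ k)).op :=
    fun k => P.incl.naturality (SimplexCategory.δ k).op
  obtain ⟨g, hg⟩ : ∃ g : Z _⦋n⦌ ⟶ (EilenbergMacLane A n) _⦋n⦌,
      q.app (op ⦋n⦌) ≫ g = φ.app (op ⦋n⦌) := by
    have w' : P.obj.δ (0 : Fin 2) ≫ i ≫ φ.app (op ⦋n⦌) = P.obj.δ (1 : Fin 2) ≫ i ≫ φ.app (op ⦋n⦌) := by
      rw [← Category.assoc, hδ, ← Category.assoc, hδ]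
      exact IsRelMor.comp_em_eq φ (P.isRelMorphism ⦋1⦌) _ _
    refine ⟨hc.desc (Cofork.ofπ _ w'), ?_⟩
    rw [← cancel_epi i, ← Category.assoc]
    exact hc.fac (Cofork.ofπ _ w') WalkingParallelPair.one
  refine em_hom_ext (eq_of_emAct_eq _ _ fun a => ?_)
  let α : ⦋n⦌ ⟶ k := SimplexCategory.mkHom a
  have e : (x ≫ X.map α.op) ≫ φ.app (op ⦋n⦌) = (y ≫ X.map α.op) ≫ φ.app (op ⦋n⦌) := by
    rw [← hg, Category.assoc, Category.assoc, ← Category.assoc (X.map α.op), q.naturality,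
      ← Category.assoc, ← Category.assoc, hxy]
    simp
  have e1 := emCoord_face φ x α
  rw [e, emCoord_face] at e1
  exact (congrFun e1 (idSurj n)).symm

/-- A map to `K(A, n)` factors uniquely through a strictification. -/
theorem IsStrictification.existsUnique_factorization (hW : IsCoverClass W)
    (h : IsStrictification W n f q t) (hq : HasMatching W q) (φ : X ⟶ EilenbergMacLane A n) :
    ∃! ψ : Z ⟶ EilenbergMacLane A n, q ≫ ψ = φ := by
  have hcov : ∀ k : SimplexCategoryᵒᵖ, W (q.app k) := fun k => hq.cover_app hW k.unop
  have hepi : ∀ k : SimplexCategoryᵒᵖ, Epi (q.app k) := fun k => hW.epi (hcov k)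
  -- As `φ` equalizes the kernel pair of the cover `q_k`, it descends degree by degree; the
  -- descended maps are natural because each `q_k` is an epimorphism.
  have hex : ∀ k : SimplexCategoryᵒᵖ, ∃ g : Z.obj k ⟶ (EilenbergMacLane A n).obj k,
      q.app k ≫ g = φ.app k := by
    intro k
    have := hW.hasPullback _ (q.app k) (hcov k)
    obtain ⟨hc⟩ := hW.effectiveEpi _ _ _ (IsPullback.of_hasPullback (q.app k) (q.app k)) (hcov k)
    have w := h.comp_em_eq φ (k := k.unop) _ _ (pullback.condition (f := q.app k) (g := q.app k))
    exact ⟨hc.desc (Cofork.ofπ _ w), hc.fac (Cofork.ofπ _ w) WalkingParallelPair.one⟩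
  choose g hg using hex
  refine ⟨{ app := g, naturality := fun k k' θ => ?_ }, ?_, fun ψ hψ => ?_⟩
  · rw [← cancel_epi (q.app k), ← Category.assoc, ← q.naturality, Category.assoc, hg, φ.naturality,
      ← Category.assoc, hg]
  · ext k
    exact hg k
  · ext k
    rw [← cancel_epi (q.app k)]
    exact (congrArg (fun ξ => ξ.app k) hψ).trans (hg k).symm

end Factorization

end LieStack

/-- Every `A`-valued `n`-cocycle `c` on `W̄ G` has an `n`-strictification `c.U --q--> τ --t--> W̄ G`
of its hypercover `c.f`; the map `c.φ` factors uniquely through `q`; and the factorization is an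
equivalence, with legs `𝟙` and `q`, of the cocycle `c` and the cocycle on `τ` which it defines. -/
theorem mainTheorem8 {C : Type u} [Category.{v} C] [CartesianMonoidalCategory C] [BraidedCategory C]
    (W : MorphismProperty C) (hW : LieStack.IsCoverClass W)
    (G A : C) [GrpObj G] [GrpObj A] [IsCommMonObj A] (n : ℕ)
    (c : LieStack.Cocycle W G A n) :
    (∃ (τ : SimplicialObject C) (q : c.U ⟶ τ) (t : τ ⟶ LieStack.Wbar G),
      LieStack.IsStrictification W n c.f q t) ∧
    ∀ (τ : SimplicialObject C) (q : c.U ⟶ τ) (t : τ ⟶ LieStack.Wbar G),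
      LieStack.IsStrictification W n c.f q t →
      (∃! ψ : τ ⟶ LieStack.EilenbergMacLane A n, q ≫ ψ = c.φ) ∧
      ∀ ψ : τ ⟶ LieStack.EilenbergMacLane A n, q ≫ ψ = c.φ →
        ∃ ht : LieStack.IsHypercover W ⊤ t,
          LieStack.IsEquivalence c ⟨τ, t, ψ, ht⟩ c (𝟙 c.U) q := by
  have hf := c.isHypercover.hasMatching
  refine ⟨hf.exists_isStrictification hW n, fun τ q t h => ?_⟩
  have hcosk := h.isCoskeletal hW hf
  have ht := hcosk.hasMatching hW hf h.fac h.isIso_app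
  have hq := hcosk.hasMatching_left hW hf h.fac h.isIso_app
  have hτ := ht.isLieGroupoid hW c.isHypercover.target
  refine ⟨h.existsUnique_factorization hW hq c.φ, fun ψ hψ =>
    ⟨ht.isHypercover hτ c.isHypercover.target, ?_⟩⟩
  exact
    { comm_f₀ := Category.id_comp _
      comm_φ₀ := Category.id_comp _
      comm_f₁ := h.fac
      comm_φ₁ := hψ
      isHypercover₀ := (LieStack.HasMatching.id hW c.U).isHypercover c.isHypercover.source
        c.isHypercover.source
      isHypercover₁ := hq.isHypercover c.isHypercover.source hτ }
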